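/- Let $d\ge 1$, $\alpha_i\in(1,2)$, $d_{i,+},d_{i,-}\ge 0$ with $d_{i,+}+d_{i,-}>0$ $(1\le i\le d)$, and put $$\mu:=\max_{1\le i\le d}\frac{|d_{i,+}-d_{i,-}|}{d_{i,+}+d_{i,-}}\,\Bigl|\tan\bigl(\tfrac{\alpha_i}{2}\pi\bigr)\Bigr|.$$ For a mesh, that is, a box $\prod_{i=1}^d(a_i,b_i)$ with $a_i<b_i$, integers $n_1,\dots,n_d\ge 1$ and a time step $\delta>0$, put $\nu=1/\delta$, $n=n_1\cdots n_d$, $h_i=(b_i-a_i)/(n_i+1)$, $v_{i,\pm}=d_{i,\pm}/(2h_i^{\alpha_i})$. For $\alpha\in(1,2)$ let $g_0^{(\alpha)}=1$, $g_k^{(\alpha)}=\bigl(1-\frac{\alpha+1}{k}\bigr)g_{k-1}^{(\alpha)}$, $w_0^{(\alpha)}=\frac{\alpha}{2}g_0^{(\alpha)}$, $w_k^{(\alpha)}=\frac{\alpha}{2}g_k^{(\alpha)}+\frac{2-\alpha}{2}g_{k-1}^{(\alpha)}$ $(k\ge1)$, and let $L_m^{(\alpha)}\in\mathbb R^{m\times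 m}$ be the Toeplitz matrix with $(j,k)$ entry $-w_{j-k+1}^{(\alpha)}$ if $k\le j+1$ and $0$ otherwise. For a symmetric Toeplitz matrix $T$ with first column $(t_1,\dots,t_m)^\top$ let $\tau(T)=T-H$, where $H$ is the $m\times m$ Hankel matrix with first column $(t_3,\dots,t_m,0,0)^\top$ and last column $(0,0,t_m,\dots,t_3)^\top$ ($H=0$ if $m\le2$); write $\mathcal H(Z)=\frac12(Z+Z^\top)$, and let $Y_m$ be the $m\times m$ matrix with ones on the anti-diagonal and zeros elsewhere. With $W_i=I_{n_1\cdots n_{i-1}}\otimes L_{n_i}^{(\alpha_i)}\otimes I_{n_{i+1}\cdots n_d}$ define $$A_n=\nu I_n+\sum_{i=1}^d\bigl(v_{i,+}W_i+v_{i,-}W_i^\top\bigr),\qquad P_n=\nu I_n+\sum_{i=1}^d(v_{i,+}+v_{i,-})\,I_{n_1\cdots n_{i-1}}\otimes\tau\bigl(\mathcal H(L_{n_i}^{(\alpha_i)})\bigr)\otimes I_{n_{i+1}\cdots n_d},$$ and $Y_n=Y_{n_1}\otimes\cdots\otimes Y_{n_d}$. For $\varepsilon\in\mathbb R$ let $$J_\varepsilon=\Bigl(-\tfrac32(1+\varepsilon),-\tfrac12\Bigr)\cup\Bigl(\tfrac12,\tfrac32(1+\varepsilon)\Bigr).$$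 1. For every mesh, $P_n$ is invertible and there is $\varepsilon<\mu$ such that all eigenvalues of $P_n^{-1}Y_nA_n$ are real and lie in $J_\varepsilon$. 2. The bound does not depend on the mesh: there is $\varepsilon\ge 0$, depending only on $d$, the $\alpha_i$ and the $d_{i,\pm}$, with $\varepsilon<\mu$ if $\mu>0$ and $\varepsilon=0$ if $\mu=0$, such that for every mesh all eigenvalues of $P_n^{-1}Y_nA_n$ lie in $J_\varepsilon$. -/

import Mathlib

namespace FracTau

/-- The Grünwald coefficients `g_0 = 1`, `g_k = (1 - (α + 1) / k) g_{k-1}` for `k ≥ 1`. -/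
noncomputable def grunwaldCoeff (α : ℝ) : ℕ → ℝ
  | 0 => 1
  | k + 1 => (1 - (α + 1) / ((k : ℝ) + 1)) * grunwaldCoeff α k

/-- The weighted and shifted Grünwald coefficients
`w_0 = (α / 2) g_0`, `w_k = (α / 2) g_k + ((2 - α) / 2) g_{k-1}` for `k ≥ 1`. -/
noncomputable def wsgCoeff (α : ℝ) : ℕ → ℝ
  | 0 => α / 2 * grunwaldCoeff α 0
  | k + 1 => α / 2 * grunwaldCoeff α (k + 1) + (2 - α) / 2 * grunwaldCoeff α k

/-- The `m × m` lower Hessenberg Toeplitz matrix `L_m^{(α)}`: its `(j, k)` entry is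
`-w_{j-k+1}` if `k ≤ j + 1`, and `0` otherwise. -/
noncomputable def grunwaldMatrix (α : ℝ) (m : ℕ) : Matrix (Fin m) (Fin m) ℝ :=
  Matrix.of fun j k =>
    if (k : ℕ) ≤ (j : ℕ) + 1 then -wsgCoeff α ((j : ℕ) + 1 - (k : ℕ)) else 0

/-- The symmetric part `(Z + Zᵀ) / 2` of a real square matrix. -/
noncomputable def symPart {ι : Type*} (Z : Matrix ι ι ℝ) : Matrix ι ι ℝ :=
  (1 / 2 : ℝ) • (Z + Z.transpose)

/-- The first column of `T`, indexed from `0` and extended by zero. With `t_1, …, t_m` the entries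
of that column, `firstColumn T k = t_{k+1}`. -/
def firstColumn {m : ℕ} (T : Matrix (Fin m) (Fin m) ℝ) (k : ℕ) : ℝ :=
  if h : k < m then T ⟨k, h⟩ ⟨0, Nat.zero_lt_of_lt h⟩ else 0

/-- The `m × m` Hankel matrix with first column `(t_3, t_4, …, t_m, 0, 0)` and last column
`(0, 0, t_m, …, t_4, t_3)`, where `(t_1, …, t_m)` is the first column of `T`. Rows and columns are
indexed from `0`, so the entry depends on `i + j ∈ {0, …, 2 m - 2}`. -/
def hankelCorrection {m : ℕ} (T : Matrix (Fin m) (Fin m) ℝ) : Matrix (Fin m) (Fin m) ℝ :=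
  Matrix.of fun i j =>
    if (i : ℕ) + j + 2 < m then firstColumn T ((i : ℕ) + j + 2)
    else if m + 1 ≤ (i : ℕ) + j then firstColumn T (2 * m - ((i : ℕ) + j))
    else 0

/-- The Tau approximation `τ(T) = T - H` of a symmetric Toeplitz matrix `T`. -/
def tauMatrix {m : ℕ} (T : Matrix (Fin m) (Fin m) ℝ) : Matrix (Fin m) (Fin m) ℝ :=
  T - hankelCorrection T

/-- The multi-indices of the `n_1 × ⋯ × n_d` grid; there are `n_1 ⋯ n_d` of them. -/
abbrev MultiIndex {d : ℕ} (n : Fin d → ℕ) : Type := (i : Fin d) → Fin (n i)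

/-- The Kronecker product `M_1 ⊗ ⋯ ⊗ M_d`, with rows and columns labelled by multi-indices
(instead of by their position in the lexicographic order). -/
def kroneckerProd {d : ℕ} {n : Fin d → ℕ} (M : (i : Fin d) → Matrix (Fin (n i)) (Fin (n i)) ℝ) :
    Matrix (MultiIndex n) (MultiIndex n) ℝ :=
  Matrix.of fun p q => ∏ i, M i (p i) (q i)

/-- `I ⊗ ⋯ ⊗ I ⊗ M ⊗ I ⊗ ⋯ ⊗ I` with `M` in position `i`. -/
def inDirection {d : ℕ} {n : Fin d → ℕ} (i : Fin d) (M : Matrix (Fin (n i)) (Fin (n i)) ℝ) :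
    Matrix (MultiIndex n) (MultiIndex n) ℝ :=
  kroneckerProd (Function.update (fun j => (1 : Matrix (Fin (n j)) (Fin (n j)) ℝ)) i M)

/-- The `m × m` anti-identity (exchange) matrix: entry `1` where, counting from `0`,
`j + k = m - 1`, and `0` elsewhere. -/
def exchangeMatrix (m : ℕ) : Matrix (Fin m) (Fin m) ℝ :=
  Matrix.of fun j k => if (j : ℕ) + k + 1 = m then 1 else 0

/-- `Y_n = Y_{n_1} ⊗ ⋯ ⊗ Y_{n_d}`. -/
def multilevelExchange {d : ℕ} (n : Fin d → ℕ) : Matrix (MultiIndex n) (MultiIndex n) ℝ :=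
  kroneckerProd fun i => exchangeMatrix (n i)

/-- The spatial step size `h_i = (b_i - a_i) / (n_i + 1)`. -/
noncomputable def stepSize {d : ℕ} (a b : Fin d → ℝ) (n : Fin d → ℕ) (i : Fin d) : ℝ :=
  (b i - a i) / ((n i : ℝ) + 1)

/-- The scaled diffusion coefficient `v_i = c_i / (2 h_i ^ α_i)`. -/
noncomputable def scaledCoeff {d : ℕ} (α c a b : Fin d → ℝ) (n : Fin d → ℕ) (i : Fin d) : ℝ :=
  c i / (2 * stepSize a b n i ^ α i)

/-- The Crank–Nicolson / weighted and shifted Grünwald coefficient matrix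
`A_n = (1 / δ) I + ∑_i (v_{i,+} W_i + v_{i,-} W_iᵀ)`, `W_i = I ⊗ L_{n_i}^{(α_i)} ⊗ I`, for the
diffusion coefficients `dp = (d_{i,+})`, `dm = (d_{i,-})`, the box `∏ (a_i, b_i)`, the grid `n` and
the time step `δ`. -/
noncomputable def coeffMatrix {d : ℕ} (α dp dm a b : Fin d → ℝ) (n : Fin d → ℕ) (δ : ℝ) :
    Matrix (MultiIndex n) (MultiIndex n) ℝ :=
  (1 / δ) • (1 : Matrix (MultiIndex n) (MultiIndex n) ℝ) +
    ∑ i, (scaledCoeff α dp a b n i • inDirection i (grunwaldMatrix (α i) (n i)) +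
      scaledCoeff α dm a b n i • (inDirection i (grunwaldMatrix (α i) (n i))).transpose)

/-- The multilevel Tau preconditioner
`P_n = (1 / δ) I + ∑_i (v_{i,+} + v_{i,-}) I ⊗ τ(H(L_{n_i}^{(α_i)})) ⊗ I`, with `H` the symmetric
part. -/
noncomputable def tauPreconditioner {d : ℕ} (α dp dm a b : Fin d → ℝ) (n : Fin d → ℕ) (δ : ℝ) :
    Matrix (MultiIndex n) (MultiIndex n) ℝ :=
  (1 / δ) • (1 : Matrix (MultiIndex n) (MultiIndex n) ℝ) +
    ∑ i, (scaledCoeff α dp a b n i + scaledCoeff α dm a b n i) •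
      inDirection i (tauMatrix (symPart (grunwaldMatrix (α i) (n i))))

/-- The preconditioned symmetrized matrix `P_n⁻¹ Y_n A_n`. -/
noncomputable def preconditionedMatrix {d : ℕ} (α dp dm a b : Fin d → ℝ) (n : Fin d → ℕ) (δ : ℝ) :
    Matrix (MultiIndex n) (MultiIndex n) ℝ :=
  (tauPreconditioner α dp dm a b n δ)⁻¹ * (multilevelExchange n * coeffMatrix α dp dm a b n δ)

/-- `max_i |d_{i,+} - d_{i,-}| / (d_{i,+} + d_{i,-}) * |tan (α_i π / 2)|`. -/
noncomputable def epsBound {d : ℕ} [NeZero d] (α dp dm : Fin d → ℝ) : ℝ :=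
  Finset.univ.sup' Finset.univ_nonempty fun i : Fin d =>
    |dp i - dm i| / (dp i + dm i) * |Real.tan (α i / 2 * Real.pi)|

/-- All complex eigenvalues of the real matrix `X` are real and lie in `S`. -/
def EigenvaluesIn {ι : Type*} [Fintype ι] [DecidableEq ι] (X : Matrix ι ι ℝ) (S : Set ℝ) : Prop :=
  ∀ z : ℂ, Module.End.HasEigenvalue (Matrix.toLin' (X.map Complex.ofReal)) z →
    ∃ x ∈ S, (x : ℂ) = z

/-- The set `(-(3/2)(1+ε), -1/2) ∪ (1/2, (3/2)(1+ε))`. -/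
def spectralSet (ε : ℝ) : Set ℝ :=
  Set.Ioo (-(3 / 2 * (1 + ε))) (-(1 / 2)) ∪ Set.Ioo (1 / 2) (3 / 2 * (1 + ε))

end FracTau

/-!
The exchange matrix `Y` is a symmetric involution, `Y A` is symmetric, and the positive definite `P`
commutes with `Y`. Hence `P⁻¹ Y A` has real spectrum, and an eigenpair satisfies
`A x = r • P (Y x)`.

Two estimates bound `r`. First, `P` is equivalent to the symmetric part `H` of `A`, with
`P / 2 < H < 3 P / 2`: for a Toeplitz matrix `T` with Hankel correction `τ T = T - K`, both
inequalities reduce to the diagonal dominance of `T + K` and of `T - 3 K`. Second, the generating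
symbol of the weighted Grünwald coefficients has argument bounded as that of `(1 - e^{iθ})^α`, which
puts the numerical range of `A` in the sector `|Im z| ≤ μ Re z`, so that
`(y ⬝ A x)² ≤ (1 + μ²) (x ⬝ A x) (y ⬝ A y)`. Testing with `y = Y x`, which exchanges `A` and `Aᵀ`,
yields `1/2 < |r| < (3/2) √(1 + μ²)`, and `√(1 + μ²) - 1 < μ` if `μ > 0`. For a fixed mesh the
spectrum is finite, which leaves room for a smaller `ε`.
-/

namespace FracTau

open Matrix

/-! ### The Grünwald coefficients -/

theorem succ_mul_grunwaldCoeff_succ (α : ℝ) (k : ℕ) :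
    (k + 1) * grunwaldCoeff α (k + 1) = (k - α) * grunwaldCoeff α k := by
  rw [grunwaldCoeff]
  field_simp
  ring

theorem grunwaldCoeff_eq_neg_one_pow_mul_choose (α : ℝ) (k : ℕ) :
    grunwaldCoeff α k = (-1) ^ k * Ring.choose α k := by
  induction k with
  | zero => simp [grunwaldCoeff]
  | succ k ih =>
    have choose_succ : (k + 1) * Ring.choose α (k + 1) = (α - k) * Ring.choose α k := by
      rw [Ring.choose_eq_smul, Ring.choose_eq_smul, descPochhammer_succ_right]
      simp only [Polynomial.smeval_mul, Polynomial.smeval_sub, Polynomial.smeval_X, pow_one,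
        Polynomial.smeval_natCast, pow_zero, nsmul_eq_mul, mul_one, smul_eq_mul, Nat.factorial_succ,
        Nat.cast_mul, Nat.cast_succ]
      field_simp
    apply mul_left_cancel₀ (Nat.cast_add_one_ne_zero (R := ℝ) k)
    rw [succ_mul_grunwaldCoeff_succ, ih, mul_left_comm _ (_ ^ (k + 1)), choose_succ]
    ring

theorem mul_sum_range_succ_grunwaldCoeff (α : ℝ) (N : ℕ) :
    α * ∑ k ∈ Finset.range (N + 1), grunwaldCoeff α k = -((N + 1) * grunwaldCoeff α (N + 1)) := by
  induction N with
  | zero => simp [grunwaldCoeff]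
  | succ N ih =>
    rw [Finset.sum_range_succ, mul_add, ih]
    have := succ_mul_grunwaldCoeff_succ α (N + 1)
    push_cast at this ⊢
    linarith

theorem grunwaldCoeff_add_two_nonneg {α : ℝ} (h1 : 1 ≤ α) (h2 : α ≤ 2) (k : ℕ) :
    0 ≤ grunwaldCoeff α (k + 2) := by
  induction k with
  | zero =>
    have : grunwaldCoeff α 2 = α * (α - 1) / 2 := by
      simp only [grunwaldCoeff]
      push_cast
      ring
    rw [zero_add, this]
    have := sub_nonneg.2 h1
    positivity
  | succ k ih =>
    rw [grunwaldCoeff]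
    refine mul_nonneg (sub_nonneg.2 (div_le_one_of_le₀ ?_ (by positivity))) ih
    push_cast
    linarith [k.cast_nonneg (α := ℝ)]

theorem grunwaldCoeff_add_three_le {α : ℝ} (h1 : 1 ≤ α) (h2 : α ≤ 2) (k : ℕ) :
    grunwaldCoeff α (k + 3) ≤ grunwaldCoeff α (k + 2) := by
  rw [grunwaldCoeff]
  exact mul_le_of_le_one_left (grunwaldCoeff_add_two_nonneg h1 h2 k)
    (sub_le_self _ (by positivity))

theorem sum_range_add_two_grunwaldCoeff_nonpos {α : ℝ} (h1 : 1 ≤ α) (h2 : α ≤ 2) (N : ℕ) :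
    ∑ k ∈ Finset.range (N + 2), grunwaldCoeff α k ≤ 0 := by
  refine nonpos_of_mul_nonpos_right ?_ (one_pos.trans_le h1)
  rw [mul_sum_range_succ_grunwaldCoeff, neg_nonpos]
  exact mul_nonneg (by positivity) (grunwaldCoeff_add_two_nonneg h1 h2 N)

theorem summable_abs_grunwaldCoeff {α : ℝ} (h1 : 1 ≤ α) (h2 : α ≤ 2) :
    Summable fun k => |grunwaldCoeff α k| := by
  rw [← summable_nat_add_iff 2]
  simp_rw [abs_of_nonneg (grunwaldCoeff_add_two_nonneg h1 h2 _)]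
  refine summable_of_sum_range_le (grunwaldCoeff_add_two_nonneg h1 h2)
    (c := -(grunwaldCoeff α 0 + grunwaldCoeff α 1)) fun N => ?_
  have := sum_range_add_two_grunwaldCoeff_nonpos h1 h2 N
  rw [Finset.sum_range_succ', Finset.sum_range_succ'] at this
  linarith

theorem wsgCoeff_add_three_nonneg {α : ℝ} (h1 : 1 ≤ α) (h2 : α ≤ 2) (k : ℕ) :
    0 ≤ wsgCoeff α (k + 3) := by
  have := grunwaldCoeff_add_two_nonneg h1 h2 (k + 1)
  have := grunwaldCoeff_add_two_nonneg h1 h2 k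
  have := sub_nonneg.2 h2
  rw [wsgCoeff]
  positivity

theorem wsgCoeff_add_four_le {α : ℝ} (h1 : 1 ≤ α) (h2 : α ≤ 2) (k : ℕ) :
    wsgCoeff α (k + 4) ≤ wsgCoeff α (k + 3) := by
  have := grunwaldCoeff_add_three_le h1 h2 (k + 1)
  have := grunwaldCoeff_add_three_le h1 h2 k
  have := sub_nonneg.2 h2
  rw [wsgCoeff, wsgCoeff]
  gcongr

theorem wsgCoeff_three_le {α : ℝ} (h1 : 1 ≤ α) :
    wsgCoeff α 3 ≤ wsgCoeff α 0 + wsgCoeff α 2 := by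
  have difference :
      wsgCoeff α 0 + wsgCoeff α 2 - wsgCoeff α 3 = α ^ 2 * (α - 1) * (α + 4) / 12 := by
    simp only [wsgCoeff, grunwaldCoeff]
    push_cast
    ring
  have : 0 ≤ α ^ 2 * (α - 1) * (α + 4) / 12 := by
    have := sub_nonneg.2 h1
    positivity
  linarith

theorem sum_range_add_three_wsgCoeff_nonpos {α : ℝ} (h1 : 1 ≤ α) (h2 : α ≤ 2) (N : ℕ) :
    ∑ k ∈ Finset.range (N + 3), wsgCoeff α k ≤ 0 := by
  have split : ∑ k ∈ Finset.range (N + 3), wsgCoeff α k =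
      α / 2 * ∑ k ∈ Finset.range (N + 3), grunwaldCoeff α k +
        (2 - α) / 2 * ∑ k ∈ Finset.range (N + 2), grunwaldCoeff α k := by
    rw [Finset.sum_range_succ', Finset.sum_range_succ' (grunwaldCoeff α)]
    simp only [wsgCoeff, Finset.sum_add_distrib, ← Finset.mul_sum]
    ring
  rw [split]
  exact add_nonpos
    (mul_nonpos_of_nonneg_of_nonpos (by linarith)
      (sum_range_add_two_grunwaldCoeff_nonpos h1 h2 (N + 1)))
    (mul_nonpos_of_nonneg_of_nonpos (by linarith)
      (sum_range_add_two_grunwaldCoeff_nonpos h1 h2 N))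

/-! ### The generating symbol -/

section Symbol

open Complex

theorem hasSum_grunwaldCoeff_mul_pow_of_norm_lt_one (α : ℝ) {z : ℂ} (hz : ‖z‖ < 1) :
    HasSum (fun k => (grunwaldCoeff α k : ℂ) * z ^ k) ((1 - z) ^ (α : ℂ)) := by
  have h := (one_add_cpow_hasFPowerSeriesOnBall_zero (a := α)).hasSum (y := -z)
    (by simpa [← ofReal_norm] using hz)
  convert! h using 1
  · ext k
    rw [grunwaldCoeff_eq_neg_one_pow_mul_choose, binomialSeries_apply]
    simp [neg_pow z k, ofReal_choose]
    ring
  · simp [sub_eq_add_neg]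

theorem norm_grunwaldCoeff_mul_pow_le (α : ℝ) {z : ℂ} (hz : ‖z‖ ≤ 1) (k : ℕ) :
    ‖(grunwaldCoeff α k : ℂ) * z ^ k‖ ≤ |grunwaldCoeff α k| := by
  rw [norm_mul, norm_pow, norm_real, Real.norm_eq_abs]
  exact mul_le_of_le_one_right (abs_nonneg _) (pow_le_one₀ (norm_nonneg _) hz)

theorem continuousOn_one_sub_cpow {α : ℝ} (hα : 0 < α) :
    ContinuousOn (fun z : ℂ => (1 - z) ^ (α : ℂ)) (Metric.closedBall 0 1) := fun z hz => by
  have re_nonneg : 0 ≤ (1 - z).re := by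
    simpa using (re_le_norm z).trans (mem_closedBall_zero_iff.1 hz)
  exact ((continuousAt_cpow_const_of_re_pos (.inl re_nonneg) (by simpa)).comp
    (f := fun z : ℂ => 1 - z) (by fun_prop)).continuousWithinAt

theorem hasSum_grunwaldCoeff_mul_pow {α : ℝ} (h1 : 1 ≤ α) (h2 : α ≤ 2) {z : ℂ} (hz : ‖z‖ ≤ 1) :
    HasSum (fun k => (grunwaldCoeff α k : ℂ) * z ^ k) ((1 - z) ^ (α : ℂ)) := by
  have hs := summable_abs_grunwaldCoeff h1 h2
  have hEq : Set.EqOn (fun z : ℂ => ∑' k, (grunwaldCoeff α k : ℂ) * z ^ k)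
      (fun z => (1 - z) ^ (α : ℂ)) (Metric.closedBall 0 1) :=
    Set.EqOn.of_subset_closure (s := Metric.ball 0 1)
      (fun z hz =>
        (hasSum_grunwaldCoeff_mul_pow_of_norm_lt_one α (mem_ball_zero_iff.1 hz)).tsum_eq)
      (continuousOn_tsum (fun k => by fun_prop) hs
        fun k z hz => norm_grunwaldCoeff_mul_pow_le α (mem_closedBall_zero_iff.1 hz) k)
      (continuousOn_one_sub_cpow (by linarith)) Metric.ball_subset_closedBall
      (closure_ball (0 : ℂ) one_ne_zero).ge
  exact (Summable.of_norm_bounded hs (norm_grunwaldCoeff_mul_pow_le α hz)).hasSum_iff.2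
    (hEq (mem_closedBall_zero_iff.2 hz))

theorem hasSum_wsgCoeff_mul_pow {α : ℝ} (h1 : 1 ≤ α) (h2 : α ≤ 2) {z : ℂ} (hz : ‖z‖ ≤ 1) :
    HasSum (fun k => (wsgCoeff α k : ℂ) * z ^ k)
      ((α / 2 + (2 - α) / 2 * z) * (1 - z) ^ (α : ℂ)) := by
  have hg := hasSum_grunwaldCoeff_mul_pow h1 h2 hz
  rw [← hasSum_nat_add_iff' 1] at hg ⊢
  convert! (hg.mul_left (α / 2 : ℂ)).add
    ((hasSum_grunwaldCoeff_mul_pow h1 h2 hz).mul_left ((2 - α) / 2 * z)) using 1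
  · ext k
    simp only [wsgCoeff]
    push_cast
    ring
  · simp only [Finset.sum_range_one, wsgCoeff, grunwaldCoeff]
    push_cast
    ring

theorem summable_abs_wsgCoeff {α : ℝ} (h1 : 1 ≤ α) (h2 : α ≤ 2) :
    Summable fun k => |wsgCoeff α k| := by
  simpa using (hasSum_wsgCoeff_mul_pow h1 h2 (z := 1) (by simp)).summable.norm

end Symbol

section Sector

open Real

theorem cos_mul_sin_mul_le {β v : ℝ} (hβ : 0 ≤ β) (hβ' : β ≤ 1) (hv : 0 ≤ v) (hv' : v ≤ π / 2) :
    cos v * sin (β * v) ≤ β * (sin v * cos (β * v)) := by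
  have hderiv : ∀ x : ℝ, HasDerivAt
      (fun v => β * (sin v * cos (β * v)) - cos v * sin (β * v))
      ((1 - β ^ 2) * (sin x * sin (β * x))) x := fun x => by
    have hβx : HasDerivAt (fun v : ℝ => β * v) β x := by
      simpa using (hasDerivAt_id x).const_mul β
    convert! (((hasDerivAt_sin x).mul hβx.cos).const_mul β).sub
      ((hasDerivAt_cos x).mul hβx.sin) using 1
    ring
  have hmono : MonotoneOn (fun v => β * (sin v * cos (β * v)) - cos v * sin (β * v))
      (Set.Icc 0 (π / 2)) := by
    refine monotoneOn_of_hasDerivWithinAt_nonneg (convex_Icc _ _)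
      (fun x _ => (hderiv x).continuousAt.continuousWithinAt)
      (fun x _ => (hderiv x).hasDerivWithinAt) fun x hx => ?_
    rw [interior_Icc] at hx
    have hx_le : x ≤ π := by linarith [hx.2, pi_pos]
    have hsin : 0 ≤ sin x := sin_nonneg_of_nonneg_of_le_pi hx.1.le hx_le
    have hsin' : 0 ≤ sin (β * x) := sin_nonneg_of_nonneg_of_le_pi (mul_nonneg hβ hx.1.le)
      ((mul_le_of_le_one_left hx.1.le hβ').trans hx_le)
    have : 0 ≤ 1 - β ^ 2 := sub_nonneg.2 (pow_le_one₀ hβ hβ')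
    positivity
  have := hmono (Set.left_mem_Icc.2 (by positivity)) ⟨hv, hv'⟩ hv
  simp only [sin_zero, mul_zero, zero_mul, cos_zero, sub_zero] at this
  linarith

theorem abs_sin_mul_cos_sub_mul_le_of_nonneg {β u : ℝ} (hβ : 0 ≤ β) (hβ' : β ≤ 1) (hu : 0 ≤ u)
    (hu' : u ≤ π / 2) :
    |sin u * cos (β * u) - β * (cos u * sin (β * u))| * sin (β * (π / 2)) ≤
      cos (β * (π / 2)) * (β * (cos u * cos (β * u)) + sin u * sin (β * u)) := by
  have at_u := cos_mul_sin_mul_le hβ hβ' hu hu'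
  have at_complement := cos_mul_sin_mul_le hβ hβ' (v := π / 2 - u) (by linarith) (by linarith)
  rw [cos_pi_div_two_sub, sin_pi_div_two_sub, mul_sub, sin_sub, cos_sub] at at_complement
  have hs : 0 ≤ sin u * cos (β * u) := mul_nonneg
    (sin_nonneg_of_nonneg_of_le_pi hu (by linarith [pi_pos]))
    (cos_nonneg_of_mem_Icc ⟨by nlinarith [pi_pos], by nlinarith⟩)
  rw [abs_of_nonneg]
  · linarith
  · nlinarith [mul_le_mul_of_nonneg_left at_u hβ,
      mul_nonneg hs (by nlinarith : (0 : ℝ) ≤ 1 - β * β)]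

theorem abs_sin_mul_cos_sub_mul_le {β u : ℝ} (hβ : 0 ≤ β) (hβ' : β ≤ 1) (hu : |u| ≤ π / 2) :
    |sin u * cos (β * u) - β * (cos u * sin (β * u))| * sin (β * (π / 2)) ≤
      cos (β * (π / 2)) * (β * (cos u * cos (β * u)) + sin u * sin (β * u)) := by
  rcases le_total 0 u with h | h
  · exact abs_sin_mul_cos_sub_mul_le_of_nonneg hβ hβ' h (by rwa [abs_of_nonneg h] at hu)
  · have := abs_sin_mul_cos_sub_mul_le_of_nonneg hβ hβ' (neg_nonneg.2 h)
      (by rwa [abs_of_nonpos h] at hu)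
    rwa [mul_neg, sin_neg, sin_neg, cos_neg, cos_neg, neg_mul, mul_neg, mul_neg, neg_mul_neg,
      ← neg_sub', abs_neg] at this

theorem abs_tan_half_mul_pi_eq {α : ℝ} (h1 : 1 ≤ α) (h2 : α ≤ 2) :
    |tan (α / 2 * π)| = cos ((α - 1) * (π / 2)) / sin ((α - 1) * (π / 2)) := by
  have shift : α / 2 * π = (α - 1) * (π / 2) + π / 2 := by ring
  have hc : 0 ≤ cos ((α - 1) * (π / 2)) :=
    cos_nonneg_of_mem_Icc ⟨by nlinarith [pi_pos], by nlinarith [pi_pos]⟩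
  have hs : 0 ≤ sin ((α - 1) * (π / 2)) :=
    sin_nonneg_of_nonneg_of_le_pi (by nlinarith [pi_pos]) (by nlinarith [pi_pos])
  rw [shift, tan_eq_sin_div_cos, sin_add_pi_div_two, cos_add_pi_div_two, div_neg, abs_neg,
    abs_of_nonneg (div_nonneg hc hs)]

theorem abs_tan_half_mul_pi_pos {α : ℝ} (h1 : 1 < α) (h2 : α < 2) : 0 < |tan (α / 2 * π)| := by
  rw [abs_tan_half_mul_pi_eq h1.le h2.le]
  exact div_pos (cos_pos_of_mem_Ioo ⟨by nlinarith [pi_pos], by nlinarith [pi_pos]⟩)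
    (sin_pos_of_pos_of_lt_pi (by nlinarith [pi_pos]) (by nlinarith [pi_pos]))

end Sector

section Symbol

open Complex

/-- The generating symbol `-∑ w_k e^{i(k-1)θ}` of the Toeplitz matrices `L_m^{(α)}`, in closed
form. -/
noncomputable def toeplitzSymbol (α θ : ℝ) : ℂ :=
  -(α / 2 * exp (-(θ * I)) + (2 - α) / 2) * (1 - exp (θ * I)) ^ (α : ℂ)

theorem continuous_toeplitzSymbol {α : ℝ} (hα : 0 < α) : Continuous (toeplitzSymbol α) := by
  unfold toeplitzSymbol
  exact Continuous.mul (by fun_prop) ((continuousOn_one_sub_cpow hα).comp_continuous (by fun_prop)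
    fun θ => by simp [norm_exp_ofReal_mul_I])

theorem hasSum_wsgCoeff_mul_exp_pow {α : ℝ} (h1 : 1 ≤ α) (h2 : α ≤ 2) (θ : ℝ) :
    HasSum (fun k => (wsgCoeff α k : ℂ) * exp (θ * I) ^ k)
      (-(exp (θ * I) * toeplitzSymbol α θ)) := by
  convert! hasSum_wsgCoeff_mul_pow h1 h2 (norm_exp_ofReal_mul_I θ).le using 1
  have : exp (θ * I) * exp (-(θ * I)) = 1 := by rw [← exp_add, add_neg_cancel, exp_zero]
  rw [toeplitzSymbol]
  linear_combination (α / 2 * (1 - exp (θ * I)) ^ (α : ℂ)) * this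

theorem one_sub_exp_pi_sub_two_mul (u : ℝ) :
    1 - exp ((Real.pi - 2 * u : ℝ) * I) =
      (2 * Real.cos u : ℝ) * (cos (-u : ℝ) + sin (-u : ℝ) * I) := by
  rw [exp_mul_I, ← ofReal_cos, ← ofReal_sin, ← ofReal_cos, ← ofReal_sin, Real.cos_pi_sub,
    Real.sin_pi_sub, Real.cos_two_mul, Real.sin_two_mul, Real.cos_neg, Real.sin_neg]
  push_cast
  ring

theorem one_sub_exp_pi_sub_two_mul_cpow (α : ℝ) {u : ℝ} (hu : |u| < Real.pi / 2) :
    (1 - exp ((Real.pi - 2 * u : ℝ) * I)) ^ (α : ℂ) =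
      ((2 * Real.cos u) ^ α : ℝ) * exp (-(α * u) * I) := by
  obtain ⟨hu₁, hu₂⟩ := abs_lt.1 hu
  have hcos : 0 < 2 * Real.cos u := mul_pos two_pos (Real.cos_pos_of_mem_Ioo ⟨hu₁, hu₂⟩)
  rw [cpow_ofReal, one_sub_exp_pi_sub_two_mul,
    arg_mul_cos_add_sin_mul_I hcos ⟨by linarith, by linarith⟩, norm_mul, norm_real,
    norm_cos_add_sin_mul_I, mul_one, Real.norm_of_nonneg hcos.le, exp_mul_I]
  push_cast
  ring_nf

theorem toeplitzSymbol_pi_sub_two_mul (α : ℝ) {u : ℝ} (hu : |u| < Real.pi / 2) :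
    toeplitzSymbol α (Real.pi - 2 * u) = ((2 * Real.cos u) ^ α : ℝ) *
      (((α - 1) * (Real.cos u * Real.cos ((α - 1) * u)) +
          Real.sin u * Real.sin ((α - 1) * u) : ℝ) +
        (Real.sin u * Real.cos ((α - 1) * u) -
          (α - 1) * (Real.cos u * Real.sin ((α - 1) * u)) : ℝ) * I) := by
  have hexp : exp (-((Real.pi - 2 * u : ℝ) * I)) = -(exp (u * I) * exp (u * I)) := by
    rw [← exp_add, ← exp_sub_pi_mul_I]
    push_cast
    ring_nf
  have hfactor : (α - 1) * Real.cos u + Real.sin u * I =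
      α / 2 * exp (u * I) - (2 - α) / 2 * exp (-u * I) := by
    rw [exp_mul_I, exp_mul_I, cos_neg, sin_neg, ofReal_cos, ofReal_sin]
    ring
  have hphase : (Real.cos ((α - 1) * u) - Real.sin ((α - 1) * u) * I : ℂ) =
      exp (u * I) * exp (-(α * u) * I) := by
    rw [← exp_add, ← add_mul, show (u : ℂ) + -(α * u) = -((α - 1) * u) by ring, exp_mul_I, cos_neg,
      sin_neg]
    push_cast
    ring
  have hinv : exp (u * I) * exp (-u * I) = 1 := by
    rw [← exp_add, neg_mul, add_neg_cancel, exp_zero]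
  have hproduct : (((α - 1) * (Real.cos u * Real.cos ((α - 1) * u)) +
          Real.sin u * Real.sin ((α - 1) * u) : ℝ) +
        (Real.sin u * Real.cos ((α - 1) * u) -
          (α - 1) * (Real.cos u * Real.sin ((α - 1) * u)) : ℝ) * I : ℂ) =
      ((α - 1) * Real.cos u + Real.sin u * I) *
        (Real.cos ((α - 1) * u) - Real.sin ((α - 1) * u) * I) := by
    simp only [ofReal_add, ofReal_sub, ofReal_mul, ofReal_one]
    linear_combination (Real.sin u * Real.sin ((α - 1) * u) : ℂ) * I_sq
  rw [toeplitzSymbol, one_sub_exp_pi_sub_two_mul_cpow α hu, hexp, hproduct, hfactor, hphase]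
  linear_combination ((2 * Real.cos u) ^ α : ℝ) * ((2 - α) / 2) * exp (-(α * u) * I) * hinv

theorem abs_im_toeplitzSymbol_le {α : ℝ} (h1 : 1 < α) (h2 : α < 2) {θ : ℝ}
    (hθ : θ ∈ Set.Ioo 0 (2 * Real.pi)) :
    |(toeplitzSymbol α θ).im| ≤ |Real.tan (α / 2 * Real.pi)| * (toeplitzSymbol α θ).re := by
  obtain ⟨u, hu, rfl⟩ : ∃ u, |u| < Real.pi / 2 ∧ θ = Real.pi - 2 * u :=
    ⟨(Real.pi - θ) / 2, abs_lt.2 ⟨by linarith [hθ.2], by linarith [hθ.1]⟩, by ring⟩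
  have hsin : 0 < Real.sin ((α - 1) * (Real.pi / 2)) :=
    Real.sin_pos_of_pos_of_lt_pi (by nlinarith [Real.pi_pos]) (by nlinarith [Real.pi_pos])
  have hR : 0 ≤ (2 * Real.cos u) ^ α :=
    Real.rpow_nonneg (mul_nonneg zero_le_two (Real.cos_nonneg_of_mem_Icc (abs_le.1 hu.le))) α
  have sector := abs_sin_mul_cos_sub_mul_le (by linarith : 0 ≤ α - 1) (by linarith) hu.le
  rw [← le_div_iff₀ hsin, mul_div_right_comm, ← abs_tan_half_mul_pi_eq h1.le h2.le] at sector
  rw [toeplitzSymbol_pi_sub_two_mul α hu, ← mk_eq_add_mul_I, re_ofReal_mul, im_ofReal_mul, abs_mul,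
    abs_of_nonneg hR, mul_left_comm |Real.tan _|]
  exact mul_le_mul_of_nonneg_left sector hR

end Symbol

/-! ### Sectorial matrices -/

/-- The numerical range of the real matrix `A` lies in the sector `{z | |Im z| ≤ μ Re z}`. The
condition is spelled out for the vector `x + i y`, whose Rayleigh numerator has real part
`x ⬝ᵥ A *ᵥ x + y ⬝ᵥ A *ᵥ y` and imaginary part `x ⬝ᵥ A *ᵥ y - y ⬝ᵥ A *ᵥ x`. -/
structure IsSectorial {ι : Type*} [Fintype ι] (μ : ℝ) (A : Matrix ι ι ℝ) : Prop where
  dotProduct_mulVec_nonneg : ∀ x, 0 ≤ x ⬝ᵥ A *ᵥ x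
  abs_sub_le : ∀ x y, |x ⬝ᵥ A *ᵥ y - y ⬝ᵥ A *ᵥ x| ≤ μ * (x ⬝ᵥ A *ᵥ x + y ⬝ᵥ A *ᵥ y)

section Sectorial

variable {ι κ : Type*} [Fintype ι] {μ : ℝ} {A B : Matrix ι ι ℝ}

theorem dotProduct_mulVec_comm_of_isHermitian {S : Matrix ι ι ℝ} (hS : S.IsHermitian)
    (x y : ι → ℝ) : x ⬝ᵥ S *ᵥ y = y ⬝ᵥ S *ᵥ x := by
  conv_lhs => rw [← hS.eq, conjTranspose_eq_transpose_of_trivial, dotProduct_transpose_mulVec]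

theorem sq_dotProduct_mulVec_le_of_posSemidef {S : Matrix ι ι ℝ} (hS : S.PosSemidef)
    (x y : ι → ℝ) : (x ⬝ᵥ S *ᵥ y) ^ 2 ≤ (x ⬝ᵥ S *ᵥ x) * (y ⬝ᵥ S *ᵥ y) := by
  classical
  have hnonneg (u : ι → ℝ) : 0 ≤ toBilin' S u u := by
    simpa only [toBilin'_apply', star_trivial] using hS.dotProduct_mulVec_nonneg u
  have hsymm : LinearMap.IsSymm (toBilin' S) := ⟨fun u v => by
    rw [RingHom.id_apply, toBilin'_apply', toBilin'_apply',
      dotProduct_mulVec_comm_of_isHermitian hS.isHermitian]⟩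
  simpa only [toBilin'_apply'] using
    LinearMap.BilinForm.apply_sq_le_of_symm (toBilin' S) hnonneg hsymm x y

theorem symPart_mulVec (A : Matrix ι ι ℝ) (x : ι → ℝ) :
    symPart A *ᵥ x = (1 / 2 : ℝ) • (A *ᵥ x + Aᵀ *ᵥ x) := by
  rw [symPart, smul_mulVec, add_mulVec]

theorem dotProduct_symPart_mulVec (A : Matrix ι ι ℝ) (x y : ι → ℝ) :
    x ⬝ᵥ symPart A *ᵥ y = (x ⬝ᵥ A *ᵥ y + y ⬝ᵥ A *ᵥ x) / 2 := by
  rw [symPart_mulVec, dotProduct_smul, dotProduct_add, dotProduct_transpose_mulVec, smul_eq_mul]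
  ring

namespace IsSectorial

theorem of_pos (hμ : 0 < μ)
    (h : ∀ x y, |x ⬝ᵥ A *ᵥ y - y ⬝ᵥ A *ᵥ x| ≤ μ * (x ⬝ᵥ A *ᵥ x + y ⬝ᵥ A *ᵥ y)) :
    IsSectorial μ A where
  dotProduct_mulVec_nonneg x := by
    have := h x x
    rw [sub_self, abs_zero, ← two_mul] at this
    exact nonneg_of_mul_nonneg_right (nonneg_of_mul_nonneg_right this hμ) two_pos
  abs_sub_le := h

theorem of_posSemidef (hμ : 0 ≤ μ) (hA : A.PosSemidef) : IsSectorial μ A where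
  dotProduct_mulVec_nonneg := hA.dotProduct_mulVec_nonneg
  abs_sub_le x y := by
    rw [dotProduct_mulVec_comm_of_isHermitian hA.isHermitian, sub_self, abs_zero]
    exact mul_nonneg hμ
      (add_nonneg (hA.dotProduct_mulVec_nonneg x) (hA.dotProduct_mulVec_nonneg y))

theorem add (hA : IsSectorial μ A) (hB : IsSectorial μ B) : IsSectorial μ (A + B) where
  dotProduct_mulVec_nonneg x := by
    rw [add_mulVec, dotProduct_add]
    exact add_nonneg (hA.dotProduct_mulVec_nonneg x) (hB.dotProduct_mulVec_nonneg x)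
  abs_sub_le x y := by
    simp only [add_mulVec, dotProduct_add]
    calc |x ⬝ᵥ A *ᵥ y + x ⬝ᵥ B *ᵥ y - (y ⬝ᵥ A *ᵥ x + y ⬝ᵥ B *ᵥ x)|
        ≤ |x ⬝ᵥ A *ᵥ y - y ⬝ᵥ A *ᵥ x| + |x ⬝ᵥ B *ᵥ y - y ⬝ᵥ B *ᵥ x| := by
          rw [add_sub_add_comm]
          exact abs_add_le _ _
      _ ≤ _ := by linarith [hA.abs_sub_le x y, hB.abs_sub_le x y]

theorem sum {s : Finset κ} {C : κ → Matrix ι ι ℝ} (hC : ∀ k ∈ s, IsSectorial μ (C k)) :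
    IsSectorial μ (∑ k ∈ s, C k) :=
  Finset.sum_induction _ _ (fun _ _ => add) ⟨by simp, by simp⟩ hC

theorem smul_add_smul_transpose {t p q : ℝ} (hA : IsSectorial t A) (hp : 0 ≤ p) (hq : 0 ≤ q)
    (hpq : |p - q| * t ≤ μ * (p + q)) : IsSectorial μ (p • A + q • Aᵀ) := by
  have form (x y : ι → ℝ) :
      x ⬝ᵥ (p • A + q • Aᵀ) *ᵥ y = p * (x ⬝ᵥ A *ᵥ y) + q * (y ⬝ᵥ A *ᵥ x) := by
    rw [add_mulVec, smul_mulVec, smul_mulVec, dotProduct_add, dotProduct_smul, dotProduct_smul,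
      dotProduct_transpose_mulVec, smul_eq_mul, smul_eq_mul]
  refine ⟨fun x => ?_, fun x y => ?_⟩
  · have := hA.dotProduct_mulVec_nonneg x
    rw [form]
    positivity
  · have hx := hA.dotProduct_mulVec_nonneg x
    have hy := hA.dotProduct_mulVec_nonneg y
    simp only [form]
    calc |p * (x ⬝ᵥ A *ᵥ y) + q * (y ⬝ᵥ A *ᵥ x) - (p * (y ⬝ᵥ A *ᵥ x) + q * (x ⬝ᵥ A *ᵥ y))|
        = |p - q| * |x ⬝ᵥ A *ᵥ y - y ⬝ᵥ A *ᵥ x| := by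
          rw [← abs_mul]
          ring_nf
      _ ≤ |p - q| * (t * (x ⬝ᵥ A *ᵥ x + y ⬝ᵥ A *ᵥ y)) := by
          gcongr
          exact hA.abs_sub_le x y
      _ = |p - q| * t * (x ⬝ᵥ A *ᵥ x + y ⬝ᵥ A *ᵥ y) := by ring
      _ ≤ μ * (p + q) * (x ⬝ᵥ A *ᵥ x + y ⬝ᵥ A *ᵥ y) := by gcongr
      _ = _ := by ring

theorem submatrix [Fintype κ] (hA : IsSectorial μ A) (e : κ ≃ ι) :
    IsSectorial μ (A.submatrix e e) := by
  have form (x y : κ → ℝ) :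
      x ⬝ᵥ A.submatrix e e *ᵥ y = (x ∘ e.symm) ⬝ᵥ A *ᵥ (y ∘ e.symm) := by
    rw [submatrix_mulVec_equiv, ← comp_equiv_symm_dotProduct]
  constructor
  · simpa only [form] using fun x => hA.dotProduct_mulVec_nonneg (x ∘ e.symm)
  · simpa only [form] using fun x y => hA.abs_sub_le (x ∘ e.symm) (y ∘ e.symm)

open Kronecker in
theorem kronecker_one [Fintype κ] [DecidableEq κ] (hA : IsSectorial μ A) :
    IsSectorial μ (A ⊗ₖ (1 : Matrix κ κ ℝ)) := by
  have form (x y : ι × κ → ℝ) : x ⬝ᵥ (A ⊗ₖ (1 : Matrix κ κ ℝ)) *ᵥ y =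
      ∑ k, (fun i => x (i, k)) ⬝ᵥ A *ᵥ fun i => y (i, k) := by
    simp only [dotProduct, mulVec, Fintype.sum_prod_type_right, kronecker_apply, one_apply,
      mul_ite, mul_one, mul_zero, ite_mul, zero_mul]
    refine Finset.sum_congr rfl fun k _ => Finset.sum_congr rfl fun i _ => ?_
    rw [Finset.sum_comm]
    simp only [Finset.sum_ite_eq, Finset.mem_univ, if_true]
  refine ⟨fun x => ?_, fun x y => ?_⟩
  · rw [form]
    exact Finset.sum_nonneg fun k _ => hA.dotProduct_mulVec_nonneg _
  · simp only [form, ← Finset.sum_sub_distrib, ← Finset.sum_add_distrib, Finset.mul_sum]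
    exact (Finset.abs_sum_le_sum_abs _ _).trans (Finset.sum_le_sum fun k _ => hA.abs_sub_le _ _)

theorem sq_sub_le (hA : IsSectorial μ A) (x y : ι → ℝ) :
    (x ⬝ᵥ A *ᵥ y - y ⬝ᵥ A *ᵥ x) ^ 2 ≤ 4 * μ ^ 2 * ((x ⬝ᵥ A *ᵥ x) * (y ⬝ᵥ A *ᵥ y)) := by
  have quadratic (s : ℝ) : 0 ≤ μ * (y ⬝ᵥ A *ᵥ y) * (s * s) +
      -(x ⬝ᵥ A *ᵥ y - y ⬝ᵥ A *ᵥ x) * s + μ * (x ⬝ᵥ A *ᵥ x) := by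
    have := (le_abs_self _).trans (hA.abs_sub_le x (s • y))
    simp only [mulVec_smul, dotProduct_smul, smul_dotProduct, smul_eq_mul] at this
    linarith
  have := discrim_le_zero quadratic
  rw [discrim] at this
  linarith

theorem sq_dotProduct_mulVec_le (hA : IsSectorial μ A) (hS : (symPart A).PosDef) (x y : ι → ℝ) :
    (y ⬝ᵥ A *ᵥ x) ^ 2 ≤ (1 + μ ^ 2) * ((x ⬝ᵥ A *ᵥ x) * (y ⬝ᵥ A *ᵥ y)) := by
  classical
  -- Solve `S g = K x` for the symmetric part `S` and the skew part `K` of `A`: then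
  -- `y ⬝ᵥ A *ᵥ x = y ⬝ᵥ S *ᵥ (x + g)`, and the cross terms of `(x + g) ⬝ᵥ S *ᵥ (x + g)` cancel.
  have form_self (u : ι → ℝ) : u ⬝ᵥ symPart A *ᵥ u = u ⬝ᵥ A *ᵥ u := by
    rw [dotProduct_symPart_mulVec]
    ring
  obtain ⟨g, hg⟩ := mulVec_surjective_iff_isUnit.2 hS.isUnit (A *ᵥ x - symPart A *ᵥ x)
  have pair_g (u : ι → ℝ) : u ⬝ᵥ symPart A *ᵥ g = (u ⬝ᵥ A *ᵥ x - x ⬝ᵥ A *ᵥ u) / 2 := by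
    rw [hg, dotProduct_sub, dotProduct_symPart_mulVec]
    ring
  have hx := hA.dotProduct_mulVec_nonneg x
  have hy := hA.dotProduct_mulVec_nonneg y
  have hgg : g ⬝ᵥ A *ᵥ g ≤ μ ^ 2 * (x ⬝ᵥ A *ᵥ x) := by
    have pair_self := pair_g g
    rw [form_self] at pair_self
    have := hA.sq_sub_le g x
    rcases (hA.dotProduct_mulVec_nonneg g).eq_or_lt with h | h
    · rw [← h]
      positivity
    · refine le_of_mul_le_mul_left ?_ h
      nlinarith
  have hsum : (x + g) ⬝ᵥ symPart A *ᵥ (x + g) = x ⬝ᵥ A *ᵥ x + g ⬝ᵥ A *ᵥ g := by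
    rw [mulVec_add, add_dotProduct, dotProduct_add, dotProduct_add,
      dotProduct_mulVec_comm_of_isHermitian hS.isHermitian g x, pair_g x, form_self, form_self]
    ring
  calc (y ⬝ᵥ A *ᵥ x) ^ 2 = (y ⬝ᵥ symPart A *ᵥ (x + g)) ^ 2 := by
        rw [mulVec_add, dotProduct_add, pair_g, dotProduct_symPart_mulVec]
        ring
    _ ≤ (y ⬝ᵥ A *ᵥ y) * (x ⬝ᵥ A *ᵥ x + g ⬝ᵥ A *ᵥ g) := by
        rw [← form_self y, ← hsum]
        exact sq_dotProduct_mulVec_le_of_posSemidef hS.posSemidef y (x + g)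
    _ ≤ (y ⬝ᵥ A *ᵥ y) * (x ⬝ᵥ A *ᵥ x + μ ^ 2 * (x ⬝ᵥ A *ᵥ x)) := by gcongr
    _ = _ := by ring

end IsSectorial

end Sectorial

/-! ### Toeplitz matrices with sectorial symbol -/

section Fourier

open Complex intervalIntegral

theorem integral_exp_int_mul (l : ℤ) :
    ∫ θ in (0 : ℝ)..2 * Real.pi, exp (l * (θ * I)) = if l = 0 then 2 * (Real.pi : ℂ) else 0 := by
  split_ifs with h
  · simp [h]
  · have hI (θ : ℝ) : (l : ℂ) * (θ * I) = l * I * θ := by ring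
    have period : (l : ℂ) * I * ((2 * Real.pi : ℝ) : ℂ) = l * (2 * Real.pi * I) := by
      push_cast
      ring
    simp_rw [hI]
    rw [integral_exp_mul_complex (by simp [h]), period, exp_int_mul_two_pi_mul_I]
    simp

theorem integral_mul_exp_neg_int_mul_of_hasSum {c : ℕ → ℂ} {f : ℝ → ℂ}
    (hc : Summable fun k => ‖c k‖) (hf : ∀ θ : ℝ, HasSum (fun k => c k * exp (θ * I) ^ k) (f θ))
    (l : ℤ) :
    ∫ θ in (0 : ℝ)..2 * Real.pi, f θ * exp (-l * (θ * I)) =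
      2 * Real.pi * if 0 ≤ l then c l.toNat else 0 := by
  let F : ℕ → C(ℝ, ℂ) := fun k => ⟨fun θ => c k * exp ((k - l : ℤ) * (θ * I)), by fun_prop⟩
  have hF (θ : ℝ) : ∑' k, F k θ = f θ * exp (-l * (θ * I)) := by
    rw [← (hf θ).tsum_eq, ← tsum_mul_right]
    refine tsum_congr fun k => ?_
    simp only [F, ContinuousMap.coe_mk]
    rw [mul_assoc, ← exp_nat_mul, ← exp_add]
    congr 2
    push_cast
    ring
  have hnorm (k : ℕ) (θ : ℝ) : ‖F k θ‖ = ‖c k‖ := by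
    have : ((k - l : ℤ) : ℂ) * (θ * I) = (((k - l : ℤ) : ℝ) * θ : ℝ) * I := by
      push_cast
      ring
    simp only [F, ContinuousMap.coe_mk]
    rw [this, norm_mul, norm_exp_ofReal_mul_I, mul_one]
  have hintegral (k : ℕ) : ∫ θ in (0 : ℝ)..2 * Real.pi, F k θ =
      if (k : ℤ) = l then 2 * Real.pi * c k else 0 := by
    simp only [F, ContinuousMap.coe_mk]
    rw [integral_const_mul, integral_exp_int_mul, mul_ite, mul_zero, mul_comm]
    simp only [sub_eq_zero]
  have key := hasSum_intervalIntegral_of_summable_norm (a := 0) (b := 2 * Real.pi) (f := F) <|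
    hc.of_nonneg_of_le (fun _ => norm_nonneg _) fun k =>
      (ContinuousMap.norm_le _ (norm_nonneg _)).2 fun θ => (hnorm k θ).le
  simp_rw [hF, hintegral] at key
  refine key.unique ?_
  split_ifs with h
  · lift l to ℕ using h
    convert! hasSum_ite_eq l (2 * Real.pi * c l) using 2 with k
    by_cases hk : k = l <;> simp [hk]
  · have (k : ℕ) : (k : ℤ) ≠ l := by lia
    simp only [this, if_false, mul_zero, hasSum_zero]

theorem integral_mul_normSq_trigPoly {m : ℕ} {A : Matrix (Fin m) (Fin m) ℝ} {f : ℝ → ℂ}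
    (hf : Continuous f)
    (hA : ∀ j k : Fin m, ∫ θ in (0 : ℝ)..2 * Real.pi, f θ * exp (-((j : ℤ) - k : ℤ) * (θ * I)) =
      2 * Real.pi * A j k) (z : Fin m → ℂ) :
    ∫ θ in (0 : ℝ)..2 * Real.pi,
        f θ * (normSq (∑ k : Fin m, z k * exp ((k : ℕ) * (θ * I))) : ℂ) =
      2 * Real.pi * ∑ j, ∑ k, starRingEnd ℂ (z j) * z k * A j k := by
  have expand (θ : ℝ) : f θ * (normSq (∑ k : Fin m, z k * exp ((k : ℕ) * (θ * I))) : ℂ) =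
      ∑ j : Fin m, ∑ k : Fin m,
        starRingEnd ℂ (z j) * z k * (f θ * exp (-((j : ℤ) - k : ℤ) * (θ * I))) := by
    rw [normSq_eq_conj_mul_self, map_sum, Finset.sum_mul_sum, Finset.mul_sum]
    simp only [Finset.mul_sum]
    refine Finset.sum_congr rfl fun j _ => Finset.sum_congr rfl fun k _ => ?_
    have hexp : exp (-((j : ℤ) - k : ℤ) * (θ * I)) =
        starRingEnd ℂ (exp ((j : ℕ) * (θ * I))) * exp ((k : ℕ) * (θ * I)) := by
      rw [← exp_conj, ← exp_add]
      simp only [map_mul, map_natCast, conj_ofReal, conj_I]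
      congr 1
      push_cast
      ring
    rw [hexp, map_mul]
    ring
  simp_rw [expand]
  rw [integral_finsetSum fun j _ => by apply Continuous.intervalIntegrable; fun_prop,
    Finset.mul_sum]
  refine Finset.sum_congr rfl fun j _ => ?_
  rw [integral_finsetSum fun k _ => by apply Continuous.intervalIntegrable; fun_prop,
    Finset.mul_sum]
  refine Finset.sum_congr rfl fun k _ => ?_
  rw [integral_const_mul, hA]
  ring

theorem sum_conj_mul_mul_eq {ι : Type*} [Fintype ι] (A : Matrix ι ι ℝ) (x y : ι → ℝ) :
    (∑ j, ∑ k, starRingEnd ℂ ⟨x j, y j⟩ * ⟨x k, y k⟩ * A j k : ℂ) =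
      ⟨x ⬝ᵥ A *ᵥ x + y ⬝ᵥ A *ᵥ y, x ⬝ᵥ A *ᵥ y - y ⬝ᵥ A *ᵥ x⟩ := by
  apply Complex.ext
  · simp only [re_sum, dotProduct, mulVec, Finset.mul_sum, ← Finset.sum_add_distrib]
    refine Finset.sum_congr rfl fun j _ => Finset.sum_congr rfl fun k _ => ?_
    simp only [mul_re, conj_re, conj_im, neg_mul, sub_neg_eq_add, ofReal_re, mul_im, ofReal_im,
      mul_zero, sub_zero]
    ring
  · simp only [im_sum, dotProduct, mulVec, Finset.mul_sum, ← Finset.sum_sub_distrib]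
    refine Finset.sum_congr rfl fun j _ => Finset.sum_congr rfl fun k _ => ?_
    simp only [mul_im, mul_re, conj_re, conj_im, neg_mul, sub_neg_eq_add, ofReal_im, mul_zero,
      ofReal_re, zero_add]
    ring

theorem isSectorial_of_symbol {μ : ℝ} (hμ : 0 < μ) {m : ℕ} {A : Matrix (Fin m) (Fin m) ℝ}
    {f : ℝ → ℂ} (hf : Continuous f)
    (hsector : ∀ θ ∈ Set.Ioo 0 (2 * Real.pi), |(f θ).im| ≤ μ * (f θ).re)
    (hA : ∀ j k : Fin m, ∫ θ in (0 : ℝ)..2 * Real.pi, f θ * exp (-((j : ℤ) - k : ℤ) * (θ * I)) =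
      2 * Real.pi * A j k) :
    IsSectorial μ A := IsSectorial.of_pos hμ fun x y => by
  set N : ℝ → ℝ := fun θ => normSq (∑ k : Fin m, (⟨x k, y k⟩ : ℂ) * exp ((k : ℕ) * (θ * I)))
  have hN : Continuous N := continuous_normSq.comp (by fun_prop)
  have : Continuous fun θ => (f θ).re := continuous_re.comp hf
  have : Continuous fun θ => (f θ).im := continuous_im.comp hf
  have hint : IntervalIntegrable (fun θ => f θ * (N θ : ℂ)) MeasureTheory.volume 0
      (2 * Real.pi) := by
    apply Continuous.intervalIntegrable
    fun_prop
  have integral_re := reCLM.intervalIntegral_comp_comm hint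
  have integral_im := imCLM.intervalIntegral_comp_comm hint
  rw [integral_mul_normSq_trigPoly hf hA, sum_conj_mul_mul_eq, ← ofReal_ofNat, ← ofReal_mul]
    at integral_re integral_im
  simp only [reCLM_apply, imCLM_apply, re_mul_ofReal, im_mul_ofReal, re_ofReal_mul, im_ofReal_mul]
    at integral_re integral_im
  have key : |∫ θ in (0 : ℝ)..2 * Real.pi, (f θ).im * N θ| ≤
      μ * ∫ θ in (0 : ℝ)..2 * Real.pi, (f θ).re * N θ := by
    rw [← integral_const_mul]
    refine (abs_integral_le_integral_abs (by positivity)).trans <|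
      integral_mono_on_of_le_Ioo (by positivity)
        (by apply Continuous.intervalIntegrable; fun_prop)
        (by apply Continuous.intervalIntegrable; fun_prop) fun θ hθ => ?_
    rw [abs_mul, abs_of_nonneg (normSq_nonneg _ : 0 ≤ N θ), ← mul_assoc]
    exact mul_le_mul_of_nonneg_right (hsector θ hθ) (normSq_nonneg _)
  rw [integral_re, integral_im, abs_mul, abs_of_pos Real.two_pi_pos, mul_left_comm] at key
  exact le_of_mul_le_mul_left key Real.two_pi_pos

theorem integral_toeplitzSymbol_mul_exp {α : ℝ} (h1 : 1 ≤ α) (h2 : α ≤ 2) {m : ℕ}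
    (j k : Fin m) :
    ∫ θ in (0 : ℝ)..2 * Real.pi, toeplitzSymbol α θ * exp (-((j : ℤ) - k : ℤ) * (θ * I)) =
      2 * Real.pi * grunwaldMatrix α m j k := by
  have shift (θ : ℝ) : toeplitzSymbol α θ * exp (-((j : ℤ) - k : ℤ) * (θ * I)) =
      -(-(exp (θ * I) * toeplitzSymbol α θ) * exp (-((j : ℤ) - k + 1 : ℤ) * (θ * I))) := by
    have : exp (-((j : ℤ) - k : ℤ) * (θ * I)) =
        exp (θ * I) * exp (-((j : ℤ) - k + 1 : ℤ) * (θ * I)) := by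
      rw [← exp_add]
      congr 1
      push_cast
      ring
    rw [this]
    ring
  have hsummable : Summable fun k => ‖(wsgCoeff α k : ℂ)‖ := by
    simpa only [norm_real, Real.norm_eq_abs] using summable_abs_wsgCoeff h1 h2
  simp_rw [shift]
  rw [integral_neg, integral_mul_exp_neg_int_mul_of_hasSum hsummable
    (hasSum_wsgCoeff_mul_exp_pow h1 h2), grunwaldMatrix, of_apply, ← mul_neg]
  by_cases h : (k : ℕ) ≤ j + 1
  · have hjk : (j : ℤ) - k + 1 = (j + 1 - k : ℕ) := by omega
    rw [hjk, if_pos (Int.natCast_nonneg _), if_pos h, Int.toNat_natCast, ofReal_neg]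
  · have hjk : ¬ 0 ≤ (j : ℤ) - k + 1 := by omega
    rw [if_neg hjk, if_neg h, neg_zero, ofReal_zero]

end Fourier

theorem isSectorial_grunwaldMatrix {α : ℝ} (h1 : 1 < α) (h2 : α < 2) (m : ℕ) :
    IsSectorial |Real.tan (α / 2 * Real.pi)| (grunwaldMatrix α m) :=
  isSectorial_of_symbol (abs_tan_half_mul_pi_pos h1 h2) (continuous_toeplitzSymbol (by linarith))
    (fun _ hθ => abs_im_toeplitzSymbol_le h1 h2 hθ) (integral_toeplitzSymbol_mul_exp h1.le h2.le)

/-! ### Spectral equivalence of a symmetric Toeplitz matrix and its Tau approximation -/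

theorem posSemidef_of_abs_le_neg {ι : Type*} [Fintype ι] {M N : Matrix ι ι ℝ}
    (hM : M.IsHermitian) (hoff : ∀ i j, i ≠ j → |M i j| ≤ -N i j) (hdiag : ∀ i, N i i ≤ M i i)
    (hrow : ∀ i, 0 ≤ ∑ j, N i j) : M.PosSemidef := by
  classical
  refine hM.posSemidef_iff_eigenvalues_nonneg.2 fun l => ?_
  have hev : Module.End.HasEigenvalue (toLin' M) (hM.eigenvalues l) := by
    rw [Module.End.hasEigenvalue_iff_mem_spectrum, spectrum_toLin']
    exact hM.eigenvalues_mem_spectrum_real l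
  obtain ⟨i, hi⟩ := eigenvalue_mem_ball hev
  have hsum : ∑ j ∈ Finset.univ.erase i, ‖M i j‖ ≤ M i i :=
    calc ∑ j ∈ Finset.univ.erase i, ‖M i j‖ ≤ ∑ j ∈ Finset.univ.erase i, -N i j :=
          Finset.sum_le_sum fun j hj => hoff i j (Finset.ne_of_mem_erase hj).symm
      _ ≤ N i i := by
          have := hrow i
          rw [← Finset.add_sum_erase _ _ (Finset.mem_univ i)] at this
          rw [Finset.sum_neg_distrib]
          linarith
      _ ≤ M i i := hdiag i
  have := (abs_le.1 (mem_closedBall_iff_norm.1 hi)).1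
  simp only [Pi.zero_apply]
  linarith

/-- The symmetric Toeplitz matrix of order `m` with first column `t 0, …, t (m - 1)`. -/
def symToeplitz (t : ℕ → ℝ) (m : ℕ) : Matrix (Fin m) (Fin m) ℝ :=
  of fun i j => t ((i : ℤ) - j).natAbs

section SymToeplitz

variable {t : ℕ → ℝ} {m : ℕ}

theorem isHermitian_symToeplitz (t : ℕ → ℝ) (m : ℕ) : (symToeplitz t m).IsHermitian :=
  IsHermitian.ext fun i j => by
    rw [star_trivial, symToeplitz, of_apply, of_apply, ← Int.natAbs_neg, neg_sub]

theorem isHermitian_hankelCorrection (T : Matrix (Fin m) (Fin m) ℝ) :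
    (hankelCorrection T).IsHermitian :=
  IsHermitian.ext fun i j => by
    simp only [star_trivial, hankelCorrection, of_apply, add_comm (j : ℕ)]

theorem hankelCorrection_symToeplitz_apply (t : ℕ → ℝ) (i j : Fin m) :
    hankelCorrection (symToeplitz t m) i j =
      if (i : ℕ) + j + 2 < m then t (i + j + 2)
      else if m + 1 ≤ (i : ℕ) + j then t (2 * m - (i + j)) else 0 := by
  have firstColumn_eq {k : ℕ} (hk : k < m) : firstColumn (symToeplitz t m) k = t k := by
    simp [firstColumn, hk, symToeplitz]
  rw [hankelCorrection, of_apply]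
  split_ifs with h h'
  · exact firstColumn_eq h
  · exact firstColumn_eq (by omega)
  · rfl

theorem sum_range_le_sum_ite_add_ite (ht : ∀ k ≠ 0, t k ≤ 0) (i : Fin m) :
    ∑ k ∈ Finset.range m, t (k + 1) ≤ ∑ j : Fin m, ((if (j : ℕ) < i then t (i - j) else 0) +
      if (i : ℕ) + j + 2 < m then t (i + j + 2) else 0) := by
  obtain ⟨i, hi⟩ := i
  have below : (Finset.range m).filter (· < i) = Finset.range i := by
    ext j
    simp only [Finset.mem_filter, Finset.mem_range]
    omega
  have above : (Finset.range m).filter (i + · + 2 < m) = Finset.range (m - 1 - (i + 1)) := by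
    ext j
    simp only [Finset.mem_filter, Finset.mem_range]
    omega
  have reflect : ∑ j ∈ Finset.range i, t (i - j) = ∑ j ∈ Finset.range i, t (j + 1) := by
    rw [← Finset.sum_range_reflect]
    refine Finset.sum_congr rfl fun j hj => ?_
    rw [Finset.mem_range] at hj
    congr 1
    omega
  have shift : ∑ j ∈ Finset.range (m - 1 - (i + 1)), t (i + j + 2) =
      ∑ k ∈ Finset.Ico (i + 1) (m - 1), t (k + 1) := by
    rw [Finset.sum_Ico_eq_sum_range]
    refine Finset.sum_congr rfl fun j _ => ?_
    congr 1
    omega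
  rw [Fin.sum_univ_eq_sum_range (fun j => (if j < i then t (i - j) else 0) +
    if i + j + 2 < m then t (i + j + 2) else 0), Finset.sum_add_distrib, ← Finset.sum_filter,
    ← Finset.sum_filter, below, above, reflect, shift, ← Finset.sum_union]
  · rw [← neg_le_neg_iff, ← Finset.sum_neg_distrib, ← Finset.sum_neg_distrib]
    refine Finset.sum_le_sum_of_subset_of_nonneg (fun k => ?_)
      fun k _ _ => neg_nonneg.2 (ht _ k.succ_ne_zero)
    simp only [Finset.mem_union, Finset.mem_range, Finset.mem_Ico]
    omega
  · simp only [Finset.disjoint_left, Finset.mem_range, Finset.mem_Ico]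
    omega

theorem symToeplitz_apply_eq_add (t : ℕ → ℝ) (i j : Fin m) :
    symToeplitz t m i j = (if j = i then t 0 else 0) +
      (if (j : ℕ) < i then t (i - j) else 0) + if (i : ℕ) < j then t (j - i) else 0 := by
  rw [symToeplitz, of_apply]
  rcases lt_trichotomy (i : ℕ) j with h | h | h
  · rw [if_neg (by omega), if_neg (by omega), if_pos h, zero_add, zero_add]
    congr 1
    omega
  · simp [Fin.ext h]
  · rw [if_neg (by omega), if_pos h, if_neg (by omega), zero_add, add_zero]
    congr 1
    omega

theorem sum_symToeplitz_add_hankelCorrection_nonneg (ht : ∀ k ≠ 0, t k ≤ 0)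
    (hsum : ∀ N, 0 ≤ t 0 + 2 * ∑ k ∈ Finset.range N, t (k + 1)) (i : Fin m) :
    0 ≤ ∑ j, (symToeplitz t m + hankelCorrection (symToeplitz t m)) i j := by
  -- `half i j` collects the entries of row `i` left of the diagonal and in the upper left corner
  -- of the Hankel matrix; the remaining ones are its image under reversal of rows and columns.
  let half (i j : Fin m) : ℝ := (if (j : ℕ) < i then t (i - j) else 0) +
    if (i : ℕ) + j + 2 < m then t (i + j + 2) else 0
  have half_rev (j : Fin m) : half i.rev j.rev = (if (i : ℕ) < j then t (j - i) else 0) +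
      if m + 1 ≤ (i : ℕ) + j then t (2 * m - (i + j)) else 0 := by
    simp only [half, Fin.val_rev]
    congr 2 <;> first | (apply propext; omega) | (congr 1; omega)
  have hankel (j : Fin m) : hankelCorrection (symToeplitz t m) i j =
      (if (i : ℕ) + j + 2 < m then t (i + j + 2) else 0) +
        if m + 1 ≤ (i : ℕ) + j then t (2 * m - (i + j)) else 0 := by
    rw [hankelCorrection_symToeplitz_apply]
    split_ifs <;> first | omega | simp
  have split (j : Fin m) : (symToeplitz t m + hankelCorrection (symToeplitz t m)) i j =
      (if j = i then t 0 else 0) + (half i j + half i.rev j.rev) := by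
    rw [Matrix.add_apply, symToeplitz_apply_eq_add, hankel, half_rev]
    ring
  simp only [split, Finset.sum_add_distrib, Finset.sum_ite_eq', Finset.mem_univ, if_true]
  have sum_rev : ∑ j : Fin m, half i.rev j.rev = ∑ j, half i.rev j :=
    Equiv.sum_comp Fin.revPerm (half i.rev)
  linarith [hsum m, sum_range_le_sum_ite_add_ite ht i, sum_range_le_sum_ite_add_ite ht i.rev]

theorem symToeplitz_apply_nonpos (ht : ∀ k ≠ 0, t k ≤ 0) {i j : Fin m} (hij : i ≠ j) :
    symToeplitz t m i j ≤ 0 :=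
  ht _ (by omega)

theorem hankelCorrection_symToeplitz_nonpos (ht : ∀ k ≠ 0, t k ≤ 0) (i j : Fin m) :
    hankelCorrection (symToeplitz t m) i j ≤ 0 := by
  rw [hankelCorrection_symToeplitz_apply]
  split_ifs
  · exact ht _ (by omega)
  · exact ht _ (by omega)
  · rfl

theorem symToeplitz_le_hankelCorrection (ht : ∀ k ≠ 0, t k ≤ 0)
    (hmono : MonotoneOn t (Set.Ici 1)) {i j : Fin m} (hij : i ≠ j) :
    symToeplitz t m i j ≤ hankelCorrection (symToeplitz t m) i j := by
  have hmono {k l : ℕ} (hk : 1 ≤ k) (hkl : k ≤ l) : t k ≤ t l := hmono hk (hk.trans hkl) hkl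
  rw [hankelCorrection_symToeplitz_apply]
  split_ifs
  · exact hmono (by omega) (by omega)
  · exact hmono (by omega) (by omega)
  · exact symToeplitz_apply_nonpos ht hij

theorem posSemidef_symToeplitz_sub_smul_tauMatrix (ht : ∀ k ≠ 0, t k ≤ 0)
    (hsum : ∀ N, 0 ≤ t 0 + 2 * ∑ k ∈ Finset.range N, t (k + 1)) :
    (symToeplitz t m - (1 / 2 : ℝ) • tauMatrix (symToeplitz t m)).PosSemidef := by
  have eq : symToeplitz t m - (1 / 2 : ℝ) • tauMatrix (symToeplitz t m) =
      (1 / 2 : ℝ) • (symToeplitz t m + hankelCorrection (symToeplitz t m)) := by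
    rw [tauMatrix]
    module
  rw [eq]
  refine (posSemidef_of_abs_le_neg
    ((isHermitian_symToeplitz t m).add (isHermitian_hankelCorrection _)) (fun i j hij => ?_)
    (fun _ => le_rfl) (sum_symToeplitz_add_hankelCorrection_nonneg ht hsum)).smul one_half_pos.le
  exact (abs_of_nonpos (add_nonpos (symToeplitz_apply_nonpos ht hij)
    (hankelCorrection_symToeplitz_nonpos ht i j))).le

theorem posSemidef_smul_tauMatrix_sub_symToeplitz (ht : ∀ k ≠ 0, t k ≤ 0)
    (hmono : MonotoneOn t (Set.Ici 1))
    (hsum : ∀ N, 0 ≤ t 0 + 2 * ∑ k ∈ Finset.range N, t (k + 1)) :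
    ((3 / 2 : ℝ) • tauMatrix (symToeplitz t m) - symToeplitz t m).PosSemidef := by
  have eq : (3 / 2 : ℝ) • tauMatrix (symToeplitz t m) - symToeplitz t m =
      (1 / 2 : ℝ) • (symToeplitz t m - (3 : ℝ) • hankelCorrection (symToeplitz t m)) := by
    rw [tauMatrix]
    module
  rw [eq]
  refine (posSemidef_of_abs_le_neg ((isHermitian_symToeplitz t m).sub
      ((isHermitian_hankelCorrection _).smul (IsSelfAdjoint.all 3))) (fun i j hij => ?_)
    (fun i => ?_) (sum_symToeplitz_add_hankelCorrection_nonneg ht hsum)).smul one_half_pos.le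
  · have hTH := symToeplitz_le_hankelCorrection ht hmono hij
    have hH := hankelCorrection_symToeplitz_nonpos ht i j
    rw [Matrix.sub_apply, Matrix.smul_apply, Matrix.add_apply, smul_eq_mul, abs_le]
    constructor <;> linarith
  · have hH := hankelCorrection_symToeplitz_nonpos ht i i
    rw [Matrix.sub_apply, Matrix.smul_apply, Matrix.add_apply, smul_eq_mul]
    linarith

end SymToeplitz

/-- The first column of the symmetric part of `L_m^{(α)}`. -/
noncomputable def symGrunwaldCoeff (α : ℝ) : ℕ → ℝ
  | 0 => -wsgCoeff α 1
  | 1 => -(wsgCoeff α 0 + wsgCoeff α 2) / 2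
  | k + 2 => -wsgCoeff α (k + 3) / 2

theorem symPart_grunwaldMatrix (α : ℝ) (m : ℕ) :
    symPart (grunwaldMatrix α m) = symToeplitz (symGrunwaldCoeff α) m := by
  have key {i j : Fin m} (hij : (j : ℕ) ≤ i) :
      symPart (grunwaldMatrix α m) i j = symGrunwaldCoeff α (i - j) := by
    obtain ⟨k, hk⟩ := Nat.exists_eq_add_of_le hij
    simp only [symPart, grunwaldMatrix, Matrix.smul_apply, Matrix.add_apply, of_apply,
      transpose_apply, smul_eq_mul, hk]
    rw [if_pos (by omega), show (j : ℕ) + k + 1 - j = k + 1 by omega,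
      show (j : ℕ) + k - j = k by omega, show (j : ℕ) + 1 - (j + k) = 1 - k by omega]
    match k with
    | 0 =>
      rw [if_pos (by omega), symGrunwaldCoeff]
      ring
    | 1 =>
      simp only [symGrunwaldCoeff, le_refl, if_true, Nat.sub_self, Nat.reduceAdd]
      ring
    | k + 2 =>
      rw [if_neg (by omega), symGrunwaldCoeff]
      ring
  ext i j
  rcases le_total (j : ℕ) i with h | h
  · rw [key h, symToeplitz, of_apply]
    congr 1
    omega
  · have comm : symPart (grunwaldMatrix α m) i j = symPart (grunwaldMatrix α m) j i := by
      simp only [symPart, Matrix.smul_apply, Matrix.add_apply, transpose_apply, add_comm]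
    rw [comm, key h, symToeplitz, of_apply]
    congr 1
    omega

theorem symGrunwaldCoeff_nonpos {α : ℝ} (h1 : 1 ≤ α) (h2 : α ≤ 2) :
    ∀ k ≠ 0, symGrunwaldCoeff α k ≤ 0
  | 1, _ => by
    have := wsgCoeff_three_le h1
    have := wsgCoeff_add_three_nonneg h1 h2 0
    simp only [symGrunwaldCoeff]
    linarith
  | k + 2, _ => by
    have := wsgCoeff_add_three_nonneg h1 h2 k
    simp only [symGrunwaldCoeff]
    linarith

theorem monotoneOn_symGrunwaldCoeff {α : ℝ} (h1 : 1 ≤ α) (h2 : α ≤ 2) :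
    MonotoneOn (symGrunwaldCoeff α) (Set.Ici 1) := by
  refine monotoneOn_of_le_succ Set.ordConnected_Ici fun k _ hk _ => ?_
  match k, hk with
  | 1, _ =>
    have := wsgCoeff_three_le h1
    simp only [Nat.succ_eq_succ, symGrunwaldCoeff]
    linarith
  | k + 2, _ =>
    have := wsgCoeff_add_four_le h1 h2 k
    simp only [Nat.succ_eq_succ, symGrunwaldCoeff]
    linarith

theorem symGrunwaldCoeff_zero_add_nonneg {α : ℝ} (h1 : 1 ≤ α) (h2 : α ≤ 2) (N : ℕ) :
    0 ≤ symGrunwaldCoeff α 0 + 2 * ∑ k ∈ Finset.range N, symGrunwaldCoeff α (k + 1) := by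
  match N with
  | 0 =>
    simp only [symGrunwaldCoeff, wsgCoeff, grunwaldCoeff, Nat.cast_zero, Finset.range_zero,
      Finset.sum_empty]
    nlinarith
  | N + 1 =>
    have := sum_range_add_three_wsgCoeff_nonpos h1 h2 N
    rw [Finset.sum_range_succ', Finset.sum_range_succ', Finset.sum_range_succ'] at this
    rw [Finset.sum_range_succ', mul_add, Finset.mul_sum]
    simp only [symGrunwaldCoeff, mul_div_cancel₀ _ (two_ne_zero' ℝ), Finset.sum_neg_distrib]
    linarith

theorem posSemidef_symPart_grunwaldMatrix_sub_smul_tauMatrix {α : ℝ} (h1 : 1 ≤ α) (h2 : α ≤ 2)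
    (m : ℕ) :
    (symPart (grunwaldMatrix α m) -
      (1 / 2 : ℝ) • tauMatrix (symPart (grunwaldMatrix α m))).PosSemidef := by
  rw [symPart_grunwaldMatrix]
  exact posSemidef_symToeplitz_sub_smul_tauMatrix (symGrunwaldCoeff_nonpos h1 h2)
    (symGrunwaldCoeff_zero_add_nonneg h1 h2)

theorem posSemidef_smul_tauMatrix_sub_symPart_grunwaldMatrix {α : ℝ} (h1 : 1 ≤ α) (h2 : α ≤ 2)
    (m : ℕ) :
    ((3 / 2 : ℝ) • tauMatrix (symPart (grunwaldMatrix α m)) -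
      symPart (grunwaldMatrix α m)).PosSemidef := by
  rw [symPart_grunwaldMatrix]
  exact posSemidef_smul_tauMatrix_sub_symToeplitz (symGrunwaldCoeff_nonpos h1 h2)
    (monotoneOn_symGrunwaldCoeff h1 h2) (symGrunwaldCoeff_zero_add_nonneg h1 h2)

/-! ### Multilevel matrices -/

section Exchange

variable {m : ℕ}

theorem submatrix_rev_grunwaldMatrix (α : ℝ) (m : ℕ) :
    (grunwaldMatrix α m).submatrix Fin.rev Fin.rev = (grunwaldMatrix α m)ᵀ := by
  ext i j
  simp only [grunwaldMatrix, submatrix_apply, transpose_apply, of_apply, Fin.val_rev]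
  congr 1
  · apply propext
    omega
  · congr 2
    omega

theorem submatrix_rev_hankelCorrection (T : Matrix (Fin m) (Fin m) ℝ) :
    (hankelCorrection T).submatrix Fin.rev Fin.rev = hankelCorrection T := by
  ext i j
  simp only [hankelCorrection, submatrix_apply, of_apply, Fin.val_rev]
  split_ifs <;> first | rfl | omega | (congr 1; omega)

theorem submatrix_rev_tauMatrix_symPart_grunwaldMatrix (α : ℝ) (m : ℕ) :
    (tauMatrix (symPart (grunwaldMatrix α m))).submatrix Fin.rev Fin.rev =
      tauMatrix (symPart (grunwaldMatrix α m)) := by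
  rw [tauMatrix, submatrix_sub, Pi.sub_apply, Pi.sub_apply, submatrix_rev_hankelCorrection, symPart,
    submatrix_smul, Pi.smul_apply, Pi.smul_apply, submatrix_add, Pi.add_apply, Pi.add_apply,
    ← transpose_submatrix, submatrix_rev_grunwaldMatrix, transpose_transpose, add_comm]

end Exchange

section Multilevel

variable {d : ℕ} {n : Fin d → ℕ}

open Kronecker in
theorem inDirection_eq_submatrix (i : Fin d) (M : Matrix (Fin (n i)) (Fin (n i)) ℝ) :
    inDirection i M =
      (M ⊗ₖ (1 : Matrix (∀ j : {j // j ≠ i}, Fin (n j)) _ ℝ)).submatrix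
        (Equiv.piSplitAt i _) (Equiv.piSplitAt i _) := by
  ext p q
  have rest : ∏ j : {j // j ≠ i}, (1 : Matrix (Fin (n j)) (Fin (n j)) ℝ) (p j) (q j) =
      (1 : Matrix (∀ j : {j // j ≠ i}, Fin (n j)) (∀ j : {j // j ≠ i}, Fin (n j)) ℝ)
        (fun j => p j) fun j => q j := by
    simp only [one_apply, Finset.prod_ite_zero, Finset.prod_const_one, Finset.mem_univ,
      forall_const, funext_iff]
  simp only [inDirection, kroneckerProd, of_apply]
  rw [Fintype.prod_eq_mul_prod_subtype_ne _ i, submatrix_apply, kronecker_apply,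
    Equiv.piSplitAt_apply, Equiv.piSplitAt_apply, ← rest, Function.update_self]
  congr 1
  exact Finset.prod_congr rfl fun j _ => by rw [Function.update_of_ne j.2]

variable (i : Fin d) (M N : Matrix (Fin (n i)) (Fin (n i)) ℝ)

theorem inDirection_add : inDirection i (M + N) = inDirection i M + inDirection i N := by
  simp only [inDirection_eq_submatrix, add_kronecker]
  rfl

theorem inDirection_smul (c : ℝ) : inDirection i (c • M) = c • inDirection i M := by
  simp only [inDirection_eq_submatrix, smul_kronecker]
  rfl

theorem inDirection_sub : inDirection i (M - N) = inDirection i M - inDirection i N := by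
  rw [sub_eq_add_neg, ← neg_one_smul ℝ N, inDirection_add, inDirection_smul, neg_one_smul,
    ← sub_eq_add_neg]

theorem inDirection_transpose : inDirection i Mᵀ = (inDirection i M)ᵀ := by
  simp only [inDirection_eq_submatrix, transpose_submatrix, ← kroneckerMap_transpose, transpose_one]

variable {i M}

theorem posSemidef_inDirection (hM : M.PosSemidef) : (inDirection i M).PosSemidef := by
  rw [inDirection_eq_submatrix]
  exact (hM.kronecker PosSemidef.one).submatrix _

theorem IsSectorial.inDirection {μ : ℝ} (hM : IsSectorial μ M) :
    IsSectorial μ (inDirection i M) := by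
  rw [inDirection_eq_submatrix]
  exact hM.kronecker_one.submatrix _

/-- The reversal of every coordinate of a multi-index; `Y_n` is its permutation matrix. -/
def multiRev (n : Fin d → ℕ) : Equiv.Perm (MultiIndex n) :=
  Equiv.piCongrRight fun _ => Fin.revPerm

theorem symm_multiRev (n : Fin d → ℕ) : (multiRev n).symm = multiRev n :=
  rfl

theorem multilevelExchange_eq_toMatrix (n : Fin d → ℕ) :
    multilevelExchange n = (multiRev n).toPEquiv.toMatrix := by
  ext p q
  have coord (i : Fin d) : ((p i : ℕ) + q i + 1 = n i) ↔ (p i).rev = q i := by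
    rw [Fin.ext_iff, Fin.val_rev]
    omega
  simp only [multilevelExchange, kroneckerProd, exchangeMatrix, of_apply, coord,
    Finset.prod_ite_zero]
  simp [PEquiv.toMatrix_apply, multiRev, funext_iff, eq_comm]

theorem transpose_multilevelExchange (n : Fin d → ℕ) :
    (multilevelExchange n)ᵀ = multilevelExchange n := by
  rw [multilevelExchange_eq_toMatrix, ← PEquiv.toMatrix_symm, ← Equiv.toPEquiv_symm, symm_multiRev]

theorem multilevelExchange_mul_self (n : Fin d → ℕ) :
    multilevelExchange n * multilevelExchange n = 1 := by
  rw [multilevelExchange_eq_toMatrix, ← PEquiv.toMatrix_trans, ← Equiv.toPEquiv_trans]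
  nth_rw 2 [← symm_multiRev]
  rw [Equiv.self_trans_symm, Equiv.toPEquiv_refl, PEquiv.toMatrix_refl]

variable (i M) in
theorem multilevelExchange_mul_inDirection_mul :
    multilevelExchange n * inDirection i M * multilevelExchange n =
      inDirection i (M.submatrix Fin.rev Fin.rev) := by
  rw [multilevelExchange_eq_toMatrix, PEquiv.toMatrix_toPEquiv_mul, PEquiv.mul_toMatrix_toPEquiv,
    symm_multiRev]
  ext p q
  simp only [submatrix_apply, id, inDirection, kroneckerProd, of_apply]
  refine Finset.prod_congr rfl fun j _ => ?_
  rcases eq_or_ne j i with rfl | hj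
  · simp [multiRev]
  · simp [multiRev, hj, one_apply]

end Multilevel

/-! ### The coefficient matrix and its preconditioner -/

section CoeffMatrix

variable {d : ℕ} {n : Fin d → ℕ} {α dp dm a b : Fin d → ℝ} {δ : ℝ}

theorem stepSize_pos (hab : ∀ i, a i < b i) (i : Fin d) : 0 < stepSize a b n i :=
  div_pos (sub_pos.2 (hab i)) (by positivity)

theorem scaledCoeff_nonneg {c : Fin d → ℝ} (hc : ∀ i, 0 ≤ c i) (hab : ∀ i, a i < b i) (i : Fin d) :
    0 ≤ scaledCoeff α c a b n i :=
  div_nonneg (hc i) (mul_nonneg zero_le_two (Real.rpow_nonneg (stepSize_pos hab i).le _))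

theorem le_epsBound [NeZero d] (α dp dm : Fin d → ℝ) (i : Fin d) :
    |dp i - dm i| / (dp i + dm i) * |Real.tan (α i / 2 * Real.pi)| ≤ epsBound α dp dm :=
  Finset.le_sup' (fun i => |dp i - dm i| / (dp i + dm i) * |Real.tan (α i / 2 * Real.pi)|)
    (Finset.mem_univ i)

theorem epsBound_nonneg [NeZero d] (hd : ∀ i, 0 ≤ dp i + dm i) : 0 ≤ epsBound α dp dm :=
  (mul_nonneg (div_nonneg (abs_nonneg _) (hd 0)) (abs_nonneg _)).trans (le_epsBound α dp dm 0)

theorem abs_scaledCoeff_sub_mul_le [NeZero d] (hd : ∀ i, 0 < dp i + dm i)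
    (hab : ∀ i, a i < b i) (i : Fin d) :
    |scaledCoeff α dp a b n i - scaledCoeff α dm a b n i| * |Real.tan (α i / 2 * Real.pi)| ≤
      epsBound α dp dm * (scaledCoeff α dp a b n i + scaledCoeff α dm a b n i) := by
  have hs : 0 < 2 * stepSize a b n i ^ α i :=
    mul_pos two_pos (Real.rpow_pos_of_pos (stepSize_pos hab i) _)
  have hμ := le_epsBound α dp dm i
  rw [div_mul_eq_mul_div, div_le_iff₀ (hd i)] at hμ
  rw [scaledCoeff, scaledCoeff, ← sub_div, ← add_div, abs_div, abs_of_pos hs, div_mul_eq_mul_div,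
    mul_div_assoc']
  gcongr

theorem isSectorial_coeffMatrix [NeZero d] (hα : ∀ i, 1 < α i ∧ α i < 2) (hdp : ∀ i, 0 ≤ dp i)
    (hdm : ∀ i, 0 ≤ dm i) (hd : ∀ i, 0 < dp i + dm i) (hab : ∀ i, a i < b i) (hδ : 0 ≤ δ) :
    IsSectorial (epsBound α dp dm) (coeffMatrix α dp dm a b n δ) :=
  (IsSectorial.of_posSemidef (epsBound_nonneg fun i => (hd i).le)
    (PosSemidef.one.smul (one_div_nonneg.2 hδ))).add <|
      IsSectorial.sum fun i _ =>
        (isSectorial_grunwaldMatrix (hα i).1 (hα i).2 _).inDirection.smul_add_smul_transpose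
          (scaledCoeff_nonneg hdp hab i) (scaledCoeff_nonneg hdm hab i)
          (abs_scaledCoeff_sub_mul_le hd hab i)

theorem multilevelExchange_mul_coeffMatrix_mul :
    multilevelExchange n * coeffMatrix α dp dm a b n δ * multilevelExchange n =
      (coeffMatrix α dp dm a b n δ)ᵀ := by
  simp only [coeffMatrix, ← inDirection_transpose, mul_add, add_mul, Matrix.mul_sum, Matrix.sum_mul,
    Matrix.mul_smul, Matrix.smul_mul, Matrix.mul_one, multilevelExchange_mul_self,
    multilevelExchange_mul_inDirection_mul, ← transpose_submatrix, submatrix_rev_grunwaldMatrix,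
    transpose_add, transpose_sum, transpose_smul, transpose_one, transpose_transpose]

theorem isHermitian_multilevelExchange_mul_coeffMatrix :
    (multilevelExchange n * coeffMatrix α dp dm a b n δ).IsHermitian := by
  rw [IsHermitian, conjTranspose_eq_transpose_of_trivial, transpose_mul,
    transpose_multilevelExchange, ← multilevelExchange_mul_coeffMatrix_mul, Matrix.mul_assoc,
    multilevelExchange_mul_self, Matrix.mul_one]

theorem commute_multilevelExchange_tauPreconditioner :
    Commute (multilevelExchange n) (tauPreconditioner α dp dm a b n δ) := by
  have conj : multilevelExchange n * tauPreconditioner α dp dm a b n δ * multilevelExchange n =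
      tauPreconditioner α dp dm a b n δ := by
    simp only [tauPreconditioner, mul_add, add_mul, Matrix.mul_sum, Matrix.sum_mul,
      Matrix.mul_smul, Matrix.smul_mul, Matrix.mul_one, multilevelExchange_mul_self,
      multilevelExchange_mul_inDirection_mul, submatrix_rev_tauMatrix_symPart_grunwaldMatrix]
  rw [commute_iff_eq]
  nth_rw 2 [← conj]
  rw [Matrix.mul_assoc, multilevelExchange_mul_self, Matrix.mul_one]

theorem symPart_coeffMatrix :
    symPart (coeffMatrix α dp dm a b n δ) = (1 / δ) • (1 : Matrix (MultiIndex n) (MultiIndex n) ℝ) +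
      ∑ i, (scaledCoeff α dp a b n i + scaledCoeff α dm a b n i) •
        inDirection i (symPart (grunwaldMatrix (α i) (n i))) := by
  simp only [symPart, coeffMatrix, inDirection_smul, inDirection_add, inDirection_transpose,
    transpose_add, transpose_sum, transpose_smul, transpose_one, transpose_transpose]
  rw [add_add_add_comm, ← Finset.sum_add_distrib, smul_add, Finset.smul_sum]
  congr 1
  · module
  · exact Finset.sum_congr rfl fun i _ => by module

theorem posDef_smul_one_add_sum_smul_inDirection {ν : ℝ} {c : Fin d → ℝ}
    {M : ∀ i, Matrix (Fin (n i)) (Fin (n i)) ℝ} (hν : 0 < ν) (hc : ∀ i, 0 ≤ c i)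
    (hM : ∀ i, (M i).PosSemidef) :
    (ν • (1 : Matrix (MultiIndex n) (MultiIndex n) ℝ) + ∑ i, c i • inDirection i (M i)).PosDef :=
  (PosDef.one.smul hν).add_posSemidef <|
    posSemidef_sum _ fun i _ => (posSemidef_inDirection (hM i)).smul (hc i)

theorem posDef_symPart_coeffMatrix_sub_smul_tauPreconditioner (hα : ∀ i, 1 ≤ α i ∧ α i ≤ 2)
    (hdp : ∀ i, 0 ≤ dp i) (hdm : ∀ i, 0 ≤ dm i) (hab : ∀ i, a i < b i) (hδ : 0 < δ) :
    (symPart (coeffMatrix α dp dm a b n δ) -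
      (1 / 2 : ℝ) • tauPreconditioner α dp dm a b n δ).PosDef := by
  convert posDef_smul_one_add_sum_smul_inDirection (half_pos (one_div_pos.2 hδ))
    (fun i => add_nonneg (scaledCoeff_nonneg (α := α) (n := n) hdp hab i)
      (scaledCoeff_nonneg (α := α) (n := n) hdm hab i))
    (fun i => posSemidef_symPart_grunwaldMatrix_sub_smul_tauMatrix (hα i).1 (hα i).2 (n i)) using 1
  simp only [symPart_coeffMatrix, tauPreconditioner, inDirection_sub, inDirection_smul, smul_sub,
    smul_comm _ (1 / 2 : ℝ), Finset.sum_sub_distrib, ← Finset.smul_sum]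
  module

theorem posDef_smul_tauPreconditioner_sub_symPart_coeffMatrix (hα : ∀ i, 1 ≤ α i ∧ α i ≤ 2)
    (hdp : ∀ i, 0 ≤ dp i) (hdm : ∀ i, 0 ≤ dm i) (hab : ∀ i, a i < b i) (hδ : 0 < δ) :
    ((3 / 2 : ℝ) • tauPreconditioner α dp dm a b n δ -
      symPart (coeffMatrix α dp dm a b n δ)).PosDef := by
  convert posDef_smul_one_add_sum_smul_inDirection (half_pos (one_div_pos.2 hδ))
    (fun i => add_nonneg (scaledCoeff_nonneg (α := α) (n := n) hdp hab i)
      (scaledCoeff_nonneg (α := α) (n := n) hdm hab i))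
    (fun i => posSemidef_smul_tauMatrix_sub_symPart_grunwaldMatrix (hα i).1 (hα i).2 (n i)) using 1
  simp only [symPart_coeffMatrix, tauPreconditioner, inDirection_sub, inDirection_smul, smul_sub,
    smul_comm _ (3 / 2 : ℝ), Finset.sum_sub_distrib, ← Finset.smul_sum]
  module

theorem posDef_tauPreconditioner (hα : ∀ i, 1 ≤ α i ∧ α i ≤ 2)
    (hdp : ∀ i, 0 ≤ dp i) (hdm : ∀ i, 0 ≤ dm i) (hab : ∀ i, a i < b i) (hδ : 0 < δ) :
    (tauPreconditioner α dp dm a b n δ).PosDef := by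
  convert (posDef_symPart_coeffMatrix_sub_smul_tauPreconditioner (n := n) hα hdp hdm hab hδ).add
    (posDef_smul_tauPreconditioner_sub_symPart_coeffMatrix hα hdp hdm hab hδ) using 1
  module

theorem posDef_symPart_coeffMatrix (hα : ∀ i, 1 ≤ α i ∧ α i ≤ 2)
    (hdp : ∀ i, 0 ≤ dp i) (hdm : ∀ i, 0 ≤ dm i) (hab : ∀ i, a i < b i) (hδ : 0 < δ) :
    (symPart (coeffMatrix α dp dm a b n δ)).PosDef := by
  rw [← sub_add_cancel (symPart _) ((1 / 2 : ℝ) • tauPreconditioner α dp dm a b n δ)]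
  exact (posDef_symPart_coeffMatrix_sub_smul_tauPreconditioner hα hdp hdm hab hδ).add
    ((posDef_tauPreconditioner hα hdp hdm hab hδ).smul one_half_pos)

end CoeffMatrix

/-! ### The spectrum of the preconditioned matrix -/

section Spectrum

variable {ι : Type*} [Fintype ι] [DecidableEq ι]

theorem splits_charpoly_mul {Q B : Matrix ι ι ℝ} (hQ : Q.PosSemidef) (hB : B.IsHermitian) :
    (Q * B).charpoly.Splits := by
  open scoped MatrixOrder in
  obtain ⟨C, rfl⟩ := CStarAlgebra.nonneg_iff_eq_star_mul_self.1 hQ.nonneg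
  rw [star_eq_conjTranspose, Matrix.mul_assoc, charpoly_mul_comm]
  exact (isHermitian_mul_mul_conjTranspose C hB).splits_charpoly

theorem exists_eigenvector_of_splits_charpoly {X : Matrix ι ι ℝ} (hX : X.charpoly.Splits) {z : ℂ}
    (hz : Module.End.HasEigenvalue (toLin' (X.map Complex.ofReal)) z) :
    ∃ r : ℝ, (r : ℂ) = z ∧ ∃ x ≠ 0, X *ᵥ x = r • x := by
  rw [Module.End.hasEigenvalue_iff_isRoot_charpoly, charpoly_toLin',
    show X.map Complex.ofReal = X.map Complex.ofRealHom from rfl, charpoly_map] at hz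
  obtain ⟨r, rfl⟩ := hX.mem_range_of_isRoot X.charpoly_monic.ne_zero hz
  rw [Polynomial.isRoot_map_iff Complex.ofReal_injective, ← charpoly_toLin',
    ← Module.End.hasEigenvalue_iff_isRoot_charpoly] at hz
  obtain ⟨x, hx⟩ := hz.exists_hasEigenvector
  exact ⟨r, rfl, x, hx.2, hx.apply_eq_smul⟩

end Spectrum

section Bounds

variable {ι : Type*} [Fintype ι] {A P : Matrix ι ι ℝ} {r c μ : ℝ} {x y : ι → ℝ}

theorem lt_dotProduct_mulVec_of_posDef_symPart_sub (h : (symPart A - c • P).PosDef) (hx : x ≠ 0) :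
    c * (x ⬝ᵥ P *ᵥ x) < x ⬝ᵥ A *ᵥ x := by
  have := h.dotProduct_mulVec_pos hx
  rw [star_trivial, sub_mulVec, dotProduct_sub, dotProduct_symPart_mulVec, smul_mulVec,
    dotProduct_smul, smul_eq_mul] at this
  linarith

theorem dotProduct_mulVec_lt_of_posDef_sub_symPart (h : (c • P - symPart A).PosDef) (hx : x ≠ 0) :
    x ⬝ᵥ A *ᵥ x < c * (x ⬝ᵥ P *ᵥ x) := by
  have := h.dotProduct_mulVec_pos hx
  rw [star_trivial, sub_mulVec, dotProduct_sub, dotProduct_symPart_mulVec, smul_mulVec,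
    dotProduct_smul, smul_eq_mul] at this
  linarith

theorem lt_abs_of_mulVec_eq_smul (hP : P.PosDef) (hA : (symPart A - c • P).PosDef) (hx : x ≠ 0)
    (hAx : A *ᵥ x = r • P *ᵥ y) (hy : y ⬝ᵥ P *ᵥ y = x ⬝ᵥ P *ᵥ x) : c < |r| := by
  have hx_pos : 0 < x ⬝ᵥ P *ᵥ x := hP.dotProduct_mulVec_pos hx
  have cauchy_schwarz : |x ⬝ᵥ P *ᵥ y| ≤ x ⬝ᵥ P *ᵥ x := by
    refine abs_le_of_sq_le_sq ?_ hx_pos.le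
    exact (sq_dotProduct_mulVec_le_of_posSemidef hP.posSemidef x y).trans_eq (by rw [hy, sq])
  refine lt_of_mul_lt_mul_right ?_ hx_pos.le
  calc c * (x ⬝ᵥ P *ᵥ x) < x ⬝ᵥ A *ᵥ x := lt_dotProduct_mulVec_of_posDef_symPart_sub hA hx
    _ = r * (x ⬝ᵥ P *ᵥ y) := by rw [hAx, dotProduct_smul, smul_eq_mul]
    _ ≤ |r| * |x ⬝ᵥ P *ᵥ y| := by rw [← abs_mul]; exact le_abs_self _
    _ ≤ |r| * (x ⬝ᵥ P *ᵥ x) := by gcongr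

theorem abs_lt_of_mulVec_eq_smul (hP : P.PosDef) (hS : (symPart A).PosDef)
    (hA : (c • P - symPart A).PosDef) (hμ : IsSectorial μ A) (hx : x ≠ 0)
    (hAx : A *ᵥ x = r • P *ᵥ y) (hy : y ⬝ᵥ P *ᵥ y = x ⬝ᵥ P *ᵥ x) : |r| < c * √(1 + μ ^ 2) := by
  have hx_pos : 0 < x ⬝ᵥ P *ᵥ x := hP.dotProduct_mulVec_pos hx
  have hy0 : y ≠ 0 := by
    rintro rfl
    rw [zero_dotProduct] at hy
    exact hx_pos.ne hy
  have hAxx := dotProduct_mulVec_lt_of_posDef_sub_symPart hA hx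
  have hAyy := dotProduct_mulVec_lt_of_posDef_sub_symPart hA hy0
  have hAx_nonneg := hμ.dotProduct_mulVec_nonneg x
  have hAy_nonneg := hμ.dotProduct_mulVec_nonneg y
  have hc : 0 < c := pos_of_mul_pos_left (hAx_nonneg.trans_lt hAxx) hx_pos.le
  refine abs_lt_of_sq_lt_sq ?_ (by positivity)
  rw [mul_pow, Real.sq_sqrt (by positivity)]
  refine lt_of_mul_lt_mul_right ?_ (sq_nonneg (x ⬝ᵥ P *ᵥ x))
  rw [hy] at hAyy
  calc r ^ 2 * (x ⬝ᵥ P *ᵥ x) ^ 2 = (y ⬝ᵥ A *ᵥ x) ^ 2 := by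
        rw [hAx, dotProduct_smul, smul_eq_mul, hy, mul_pow]
    _ ≤ (1 + μ ^ 2) * ((x ⬝ᵥ A *ᵥ x) * (y ⬝ᵥ A *ᵥ y)) := hμ.sq_dotProduct_mulVec_le hS x y
    _ < (1 + μ ^ 2) * ((c * (x ⬝ᵥ P *ᵥ x)) * (c * (x ⬝ᵥ P *ᵥ x))) := by gcongr
    _ = _ := by ring

end Bounds

theorem mem_spectralSet_iff {x ε : ℝ} :
    x ∈ spectralSet ε ↔ 1 / 2 < |x| ∧ |x| < 3 / 2 * (1 + ε) := by
  rw [spectralSet, Set.mem_union, Set.mem_Ioo, Set.mem_Ioo]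
  rcases abs_cases x with ⟨h, _⟩ | ⟨h, _⟩ <;> grind

open Filter Topology in
theorem EigenvaluesIn.exists_lt {ι : Type*} [Fintype ι] [DecidableEq ι] {X : Matrix ι ι ℝ} {ε : ℝ}
    (h : EigenvaluesIn X (spectralSet ε)) : ∃ ε' < ε, EigenvaluesIn X (spectralSet ε') := by
  have finite := Module.End.finite_hasEigenvalue (f := toLin' (X.map Complex.ofReal))
  have near : ∀ᶠ ε' in 𝓝[<] ε,
      ∀ z ∈ {z | Module.End.HasEigenvalue (toLin' (X.map Complex.ofReal)) z},
        ∃ x ∈ spectralSet ε', (x : ℂ) = z := by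
    rw [eventually_all_finite finite]
    intro z hz
    obtain ⟨x, hx, hxz⟩ := h z hz
    rw [mem_spectralSet_iff] at hx
    have hcont : Continuous fun ε' : ℝ => 3 / 2 * (1 + ε') := by fun_prop
    filter_upwards [nhdsWithin_le_nhds (hcont.continuousAt.eventually_const_lt hx.2)] with ε' hε'
    exact ⟨x, mem_spectralSet_iff.2 ⟨hx.1, hε'⟩, hxz⟩
  obtain ⟨ε', hmem, hlt⟩ := (near.and self_mem_nhdsWithin).exists
  exact ⟨ε', hlt, hmem⟩

section Preconditioned

variable {d : ℕ} {n : Fin d → ℕ} {α dp dm a b : Fin d → ℝ} {δ : ℝ}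

theorem dotProduct_tauPreconditioner_mulVec_multilevelExchange (x : MultiIndex n → ℝ) :
    (multilevelExchange n *ᵥ x) ⬝ᵥ
        tauPreconditioner α dp dm a b n δ *ᵥ (multilevelExchange n *ᵥ x) =
      x ⬝ᵥ tauPreconditioner α dp dm a b n δ *ᵥ x := by
  rw [mulVec_mulVec, ← commute_multilevelExchange_tauPreconditioner.eq, ← mulVec_mulVec,
    ← dotProduct_transpose_mulVec, transpose_multilevelExchange, mulVec_mulVec,
    multilevelExchange_mul_self, one_mulVec, dotProduct_comm]

theorem coeffMatrix_mulVec_of_preconditionedMatrix_mulVec {r : ℝ} {x : MultiIndex n → ℝ}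
    (hP : IsUnit (tauPreconditioner α dp dm a b n δ))
    (hx : preconditionedMatrix α dp dm a b n δ *ᵥ x = r • x) :
    coeffMatrix α dp dm a b n δ *ᵥ x =
      r • tauPreconditioner α dp dm a b n δ *ᵥ (multilevelExchange n *ᵥ x) := by
  rw [isUnit_iff_isUnit_det] at hP
  calc coeffMatrix α dp dm a b n δ *ᵥ x
      = (multilevelExchange n * tauPreconditioner α dp dm a b n δ) *ᵥ
          (preconditionedMatrix α dp dm a b n δ *ᵥ x) := by
        rw [preconditionedMatrix, mulVec_mulVec, Matrix.mul_assoc,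
          mul_nonsing_inv_cancel_left _ _ hP, ← Matrix.mul_assoc, multilevelExchange_mul_self,
          Matrix.one_mul]
    _ = _ := by
        rw [hx, commute_multilevelExchange_tauPreconditioner.eq, mulVec_smul, ← mulVec_mulVec]

theorem eigenvaluesIn_preconditionedMatrix [NeZero d] (hα : ∀ i, 1 < α i ∧ α i < 2)
    (hdp : ∀ i, 0 ≤ dp i) (hdm : ∀ i, 0 ≤ dm i) (hd : ∀ i, 0 < dp i + dm i)
    (hab : ∀ i, a i < b i) (hδ : 0 < δ) :
    EigenvaluesIn (preconditionedMatrix α dp dm a b n δ)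
      (spectralSet (√(1 + epsBound α dp dm ^ 2) - 1)) := by
  have hα' (i : Fin d) : 1 ≤ α i ∧ α i ≤ 2 := (hα i).imp le_of_lt le_of_lt
  have hP := posDef_tauPreconditioner (n := n) hα' hdp hdm hab hδ
  intro z hz
  obtain ⟨r, rfl, x, hx, hrx⟩ := exists_eigenvector_of_splits_charpoly
    (splits_charpoly_mul hP.posSemidef.inv isHermitian_multilevelExchange_mul_coeffMatrix) hz
  have hAx := coeffMatrix_mulVec_of_preconditionedMatrix_mulVec hP.isUnit hrx
  have hy := dotProduct_tauPreconditioner_mulVec_multilevelExchange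
    (α := α) (dp := dp) (dm := dm) (a := a) (b := b) (δ := δ) x
  refine ⟨r, mem_spectralSet_iff.2 ⟨?_, ?_⟩, rfl⟩
  · exact lt_abs_of_mulVec_eq_smul hP
      (posDef_symPart_coeffMatrix_sub_smul_tauPreconditioner hα' hdp hdm hab hδ) hx hAx hy
  · rw [add_sub_cancel]
    exact abs_lt_of_mulVec_eq_smul hP (posDef_symPart_coeffMatrix hα' hdp hdm hab hδ)
      (posDef_smul_tauPreconditioner_sub_symPart_coeffMatrix hα' hdp hdm hab hδ)
      (isSectorial_coeffMatrix hα hdp hdm hd hab hδ.le) hx hAx hy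

end Preconditioned

theorem sqrt_one_add_sq_sub_one_nonneg (μ : ℝ) : 0 ≤ √(1 + μ ^ 2) - 1 :=
  sub_nonneg.2 (Real.one_le_sqrt.2 (le_add_of_nonneg_right (sq_nonneg μ)))

theorem sqrt_one_add_sq_sub_one_le {μ : ℝ} (hμ : 0 ≤ μ) : √(1 + μ ^ 2) - 1 ≤ μ := by
  rw [sub_le_iff_le_add, Real.sqrt_le_left (by positivity)]
  nlinarith

theorem sqrt_one_add_sq_sub_one_lt {μ : ℝ} (hμ : 0 < μ) : √(1 + μ ^ 2) - 1 < μ := by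
  rw [sub_lt_iff_lt_add, Real.sqrt_lt' (by positivity)]
  nlinarith

end FracTau

theorem mainTheorem1 {d : ℕ} [NeZero d] (α dp dm : Fin d → ℝ)
    (hα : ∀ i, 1 < α i ∧ α i < 2)
    (hdp : ∀ i, 0 ≤ dp i) (hdm : ∀ i, 0 ≤ dm i) (hd : ∀ i, 0 < dp i + dm i) :
    (∀ (a b : Fin d → ℝ) (n : Fin d → ℕ) (δ : ℝ),
      (∀ i, a i < b i) → (∀ i, 0 < n i) → 0 < δ →
        IsUnit (FracTau.tauPreconditioner α dp dm a b n δ) ∧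
        ∃ ε < FracTau.epsBound α dp dm,
          FracTau.EigenvaluesIn (FracTau.preconditionedMatrix α dp dm a b n δ)
            (FracTau.spectralSet ε)) ∧
    (∃ ε : ℝ, 0 ≤ ε ∧ ε ≤ FracTau.epsBound α dp dm ∧
      (0 < FracTau.epsBound α dp dm → ε < FracTau.epsBound α dp dm) ∧
      ∀ (a b : Fin d → ℝ) (n : Fin d → ℕ) (δ : ℝ),
        (∀ i, a i < b i) → (∀ i, 0 < n i) → 0 < δ →
          FracTau.EigenvaluesIn (FracTau.preconditionedMatrix α dp dm a b n δ)
            (FracTau.spectralSet ε)) := by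
  have hμ := FracTau.epsBound_nonneg (α := α) fun i => (hd i).le
  have spectrum {a b : Fin d → ℝ} {n : Fin d → ℕ} {δ : ℝ} (hab : ∀ i, a i < b i) (hδ : 0 < δ) :=
    FracTau.eigenvaluesIn_preconditionedMatrix (n := n) hα hdp hdm hd hab hδ
  refine ⟨fun a b n δ hab _ hδ => ⟨?_, ?_⟩,
    √(1 + FracTau.epsBound α dp dm ^ 2) - 1, FracTau.sqrt_one_add_sq_sub_one_nonneg _,
    FracTau.sqrt_one_add_sq_sub_one_le hμ, FracTau.sqrt_one_add_sq_sub_one_lt,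
    fun a b n δ hab _ hδ => spectrum hab hδ⟩
  · have hα' i : 1 ≤ α i ∧ α i ≤ 2 := ⟨(hα i).1.le, (hα i).2.le⟩
    exact (FracTau.posDef_tauPreconditioner hα' hdp hdm hab hδ).isUnit
  · obtain ⟨ε, hε, hspec⟩ := (spectrum hab hδ).exists_lt
    exact ⟨ε, hε.trans_le (FracTau.sqrt_one_add_sq_sub_one_le hμ), hspec⟩
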